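/- For every $N\ge 1$ let $M=M^{(N)}$ be a random Hermitian $N\times N$ matrix (whose law may depend on $N$) which is a Wigner matrix: the $N^2$ real random variables $M_{ii}$ ($1\le i\le N$), $\operatorname{Re}M_{ij}$, $\operatorname{Im}M_{ij}$ ($1\le i<j\le N$) are mutually independent, the diagonal elements $M_{ii}$ are identically distributed, the variables $\operatorname{Re}M_{ij},\operatorname{Im}M_{ij}$ ($i<j$) are identically distributed (with a law possibly different from that of the diagonal elements), and $\langle M_{ij}\rangle=0$ for $i\ne j$. Assume that all moments remain finite as $N$ becomes large: for every $k\in\mathbb N$ there is a constant $C_k$ with $\langle |M_{ij}|^k\rangle\le C_k$ for all $N$ and all $i,j$. For $i\neq j$ write the second cumulant as $\langle M_{ij}M_{ji}\rangle_{\rm c}=\langle M_{ij}M_{ji}\rangle-\langle M_{ij}\rangle\langle M_{ji}\rangle=\alpha_N^2$ with $\alpha_N$ real (this cumulant is nonnegative and does not depend on $i\ne j$), and assume that $\alpha_N\to\alpha$ with $\alpha>0$; this includes the case where $\alpha_N=\alpha>0$ for all $N$. Let $\rho_N=\frac1N\sum_{i=1}^N\langle\delta_{\lambda_i}\rangle$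 be the normalised density of eigenvalues, where $\lambda_1,\dots,\lambda_N$ are the eigenvalues of $M/\sqrt N$. Then for every integer $k\ge 0$ the $k$-th moment of $\rho_N$ exists for all $N$, and $$\lim_{N\to\infty}\int_{\mathbb R}\lambda^k\,\rho_N(d\lambda)=\begin{cases}\dfrac1{2\pi\alpha^2}\displaystyle\int_{-2\alpha}^{2\alpha}\lambda^k\sqrt{4\alpha^2-\lambda^2}\,d\lambda&\text{if }k\text{ is even},\\[1ex]0&\text{if }k\text{ is odd.}\end{cases}$$ -/

import Mathlib

open MeasureTheory ProbabilityTheory Filter Topology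

noncomputable section

namespace WignerLaw

/-- Hermitian `N × N` complex matrices. -/
abbrev HermitianMatrix (N : ℕ) : Type := selfAdjoint (Matrix (Fin N) (Fin N) ℂ)

/-- The entry `A i j` of a Hermitian matrix. -/
def entry {N : ℕ} (A : HermitianMatrix N) (i j : Fin N) : ℂ :=
  (A : Matrix (Fin N) (Fin N) ℂ) i j

/-- Positions `(i, j)` strictly above the diagonal. -/
abbrev UpperIndex (N : ℕ) : Type := {p : Fin N × Fin N // p.1 < p.2}

/-- The (real) diagonal elements of a Hermitian matrix. -/
def diagonalElement {N : ℕ} (A : HermitianMatrix N) (i : Fin N) : ℝ :=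
  (entry A i i).re

/-- The real parts (left summand) and the imaginary parts (right summand) of the elements of a
Hermitian matrix strictly above the diagonal. -/
def upperPart {N : ℕ} (A : HermitianMatrix N) : UpperIndex N ⊕ UpperIndex N → ℝ
  | Sum.inl p => (entry A p.1.1 p.1.2).re
  | Sum.inr p => (entry A p.1.1 p.1.2).im

/-- The `N ^ 2` free real coordinates of a Hermitian matrix: the diagonal elements, followed by
the real and imaginary parts of the elements above the diagonal. -/
def realCoordinate {N : ℕ} (A : HermitianMatrix N) :
    Fin N ⊕ (UpperIndex N ⊕ UpperIndex N) → ℝ :=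
  Sum.elim (diagonalElement A) (upperPart A)

/-- A random Hermitian matrix `M` is a Wigner matrix if its diagonal elements are iid, the real
and imaginary parts of its elements above the diagonal are iid (with a possibly different law) and
independent of the diagonal elements, and its off-diagonal elements have expectation zero. -/
structure IsWignerMatrix {Ω : Type*} [MeasurableSpace Ω] (P : Measure Ω) {N : ℕ}
    (M : Ω → HermitianMatrix N) : Prop where
  measurable_entry : ∀ i j, Measurable fun ω => entry (M ω) i j
  indep : iIndepFun (fun a ω => realCoordinate (M ω) a) P
  identDistrib_diagonal : ∀ i j,
    IdentDistrib (fun ω => diagonalElement (M ω) i) (fun ω => diagonalElement (M ω) j) P P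
  identDistrib_upper : ∀ a b,
    IdentDistrib (fun ω => upperPart (M ω) a) (fun ω => upperPart (M ω) b) P P
  mean_offDiagonal : ∀ i j, i ≠ j → ∫ ω, entry (M ω) i j ∂P = 0

/-- The second joint cumulant `⟨X Y⟩ - ⟨X⟩⟨Y⟩` of two complex random variables. -/
def secondCumulant {Ω : Type*} [MeasurableSpace Ω] (P : Measure Ω) (X Y : Ω → ℂ) : ℂ :=
  ∫ ω, X ω * Y ω ∂P - (∫ ω, X ω ∂P) * ∫ ω, Y ω ∂P

/-- The eigenvalues, with multiplicity, of a Hermitian matrix. -/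
def eigenvalue {N : ℕ} (A : HermitianMatrix N) (i : Fin N) : ℝ :=
  (Matrix.isHermitian_iff_isSelfAdjoint.mpr A.2).eigenvalues i

/-- The normalised eigenvalue counting measure `(1 / N) ∑ i, δ_{λ i}` of a Hermitian matrix. -/
def empiricalSpectralMeasure {N : ℕ} (A : HermitianMatrix N) : Measure ℝ :=
  (N : ENNReal)⁻¹ • ∑ i, Measure.dirac (eigenvalue A i)

/-- The normalised density of eigenvalues `(1 / N) ∑ i, ⟨δ_{λ i}⟩`, where the `λ i` are the
eigenvalues of the random matrix `M / √N` and the bracket is the average over `M`. -/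
def eigenvalueDensity {Ω : Type*} [MeasurableSpace Ω] (P : Measure Ω) {N : ℕ}
    (M : Ω → HermitianMatrix N) : Measure ℝ :=
  P.bind fun ω => empiricalSpectralMeasure ((√(N : ℝ))⁻¹ • M ω)

/-- The `k`-th moment of the semi-circle law supported on `[-2α, 2α]`. -/
def semicircleMoment (α : ℝ) (k : ℕ) : ℝ :=
  if Even k then
    1 / (2 * Real.pi * α ^ 2) * ∫ x in (-2 * α)..(2 * α), x ^ k * √(4 * α ^ 2 - x ^ 2)
  else 0

end WignerLaw

end

/-! The proof follows the diagonal entries of powers instead of counting pairings of walks. Cutting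
a closed walk at `i` at its first return (`minor_pow_apply_self`) expresses the diagonal entry of a
power through a loop at `i`, shorter powers, and excursions. An excursion of `r + 2` steps is a
quadratic form in row `i`, whose coefficients are the entries of the `r`-th power of the minor
without `i`, and these are independent of that row. Such a form concentrates around the variance
times the trace of that power (`lintegral_excursion_sub_le`). After scaling, the loop is negligible
and the trace term tends to `α ^ 2` times the limit `m r` of a diagonal entry. Hence the limits
satisfy `m (k + 2) = ∑ α ^ 2 * m r * m (k - r)`, with `m 0 = 1` and `m 1 = 0`: the Catalan
recursion, which the semicircle moments satisfy too.

Each excursion removes an index, so the induction cannot stay with the full matrix. Convergence is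
therefore proved in `L²` for all minors with almost all rows and for all roots at once
(`minorFilter`, `tendsToConst_returnEntry`).

Limits are multiplied in this recursion, so `L²` convergence is paired with uniform bounds on all
moments. Those come from a walk count: an edge crossed once has mean zero, hence a contributing walk
of `k` steps finds at most `k / 2` new vertices, and the expected entry of the unscaled `k`-th power
is `O(N ^ (k / 2))`. The inequality `|(A ^ k) i i| ^ 2 ≤ (A ^ (2 * k)) i i` for Hermitian `A` lifts
this to higher moments.

The last ingredient identifies the moments of the averaged spectral measure with expected normalised
traces, which needs measurability of the empirical measure. -/

namespace WignerLaw

open scoped NNReal ENNReal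
open Finset.HasAntidiagonal (antidiagonal)

/-! ### Counting walks whose edges are repeated. -/

section Walks

variable {n : Type*} [Fintype n] [DecidableEq n]

/-- Entries of a matrix power as a sum over walks. -/
theorem pow_apply_eq_sum_walks {R : Type*} [CommSemiring R] (A : Matrix n n R) (k : ℕ) (i j : n) :
    (A ^ k) i j = ∑ w : Fin (k + 1) → n, if w 0 = i ∧ w (Fin.last k) = j then
      ∏ t : Fin k, A (w t.castSucc) (w t.succ) else 0 := by
  induction k generalizing i with
  | zero =>
    rw [← (Equiv.funUnique (Fin 1) n).symm.sum_comp]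
    have : ∀ x : n, ((x = i ∧ x = j) ↔ (x = i ∧ i = j)) := by
      intro x; constructor <;> rintro ⟨rfl, rfl⟩ <;> simp
    simp [Matrix.one_apply, Equiv.funUnique, this, ite_and]
  | succ k ih =>
    have hR : (∑ w : Fin (k + 2) → n, if w 0 = i ∧ w (Fin.last (k + 1)) = j then
        ∏ t : Fin (k + 1), A (w t.castSucc) (w t.succ) else 0)
        = ∑ w : Fin (k + 1) → n, if w (Fin.last k) = j then
          A i (w 0) * ∏ t : Fin k, A (w t.castSucc) (w t.succ) else 0 := by
      rw [← (Fin.consEquiv (fun _ : Fin (k + 2) => n)).sum_comp, Fintype.sum_prod_type]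
      simp only [Fin.consEquiv_apply, Fin.cons_zero, ← Fin.succ_last, Fin.cons_succ,
        Fin.prod_univ_succ, Fin.castSucc_zero, ← Fin.succ_castSucc]
      rw [Finset.sum_eq_single i (fun b _ hb => by simp [hb]) (by simp)]
      simp
    rw [hR, pow_succ', Matrix.mul_apply]
    simp only [ih, Finset.mul_sum]
    rw [Finset.sum_comm]
    refine Finset.sum_congr rfl fun w _ => ?_
    rw [Finset.sum_eq_single (w 0) (fun b _ hb => by simp [Ne.symm hb]) (by simp)]
    simp

/-- Every step of the walk between two different vertices runs along an edge used again. -/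
def EdgesRepeated {k : ℕ} (w : Fin (k + 1) → n) : Prop :=
  ∀ t : Fin k, w t.castSucc ≠ w t.succ →
    ∃ t', t' ≠ t ∧ s(w t'.castSucc, w t'.succ) = s(w t.castSucc, w t.succ)

omit [Fintype n] [DecidableEq n] in
theorem exists_first_visit {k : ℕ} (w : Fin (k + 1) → n) {v : n} (hv : v ∈ Set.range w)
    (h0 : v ≠ w 0) : ∃ t : Fin k, w t.succ = v ∧ ∀ s ≤ t.castSucc, w s ≠ v := by
  classical
  have hne : (Finset.univ.filter fun s => w s = v).Nonempty := by
    obtain ⟨s, hs⟩ := hv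
    exact ⟨s, by simp [hs]⟩
  obtain ⟨s, hs, hmin⟩ := Finset.exists_min_image _ id hne
  simp only [Finset.mem_filter, Finset.mem_univ, true_and, id] at hs hmin
  have hs0 : s ≠ 0 := by rintro rfl; exact h0 hs.symm
  obtain ⟨t, rfl⟩ := Fin.exists_succ_eq.mpr hs0
  refine ⟨t, hs, fun s' hs' h => ?_⟩
  have := (hmin s' h).trans hs'
  exact absurd this (by simp)

omit [Fintype n] in
-- Each vertex other than the starting point is first reached along an edge of its own, and each
-- such edge is crossed at least twice among the `k` steps.
theorem card_image_le_of_edgesRepeated {k : ℕ} (w : Fin (k + 1) → n) (hw : EdgesRepeated w) :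
    2 * ((Finset.univ.image w).erase (w 0)).card ≤ k := by
  classical
  set V := (Finset.univ.image w).erase (w 0) with hV
  have hex : ∀ v : V, ∃ t : Fin k, w t.succ = v ∧ ∀ s ≤ t.castSucc, w s ≠ v := by
    rintro ⟨v, hv⟩
    simp only [hV, Finset.mem_erase, Finset.mem_image, Finset.mem_univ, true_and] at hv
    exact exists_first_visit w hv.2 hv.1
  choose τ hτ hτ' using hex
  let F : Fin k → Sym2 n := fun t => s(w t.castSucc, w t.succ)
  -- If the edges agreed, `v'` would be an endpoint of the earlier step, hence visited before its
  -- own first visit.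
  have hlt : ∀ v v' : V, F (τ v) = F (τ v') → ¬ τ v < τ v' := by
    intro v v' h hlt
    have hmem : (v' : n) ∈ F (τ v) := by rw [h, ← hτ v']; simp [F]
    simp only [F, Sym2.mem_iff] at hmem
    rcases hmem with hm | hm
    · exact hτ' v' _ (by simpa using hlt.le) hm.symm
    · exact hτ' v' (τ v).succ (by simpa [Fin.le_def] using hlt) hm.symm
  have hinj : Function.Injective fun v : V => F (τ v) := by
    intro v v' h
    have h1 := hlt v v' h
    have h2 := hlt v' v h.symm
    have h3 : τ v = τ v' := le_antisymm (not_lt.mp h2) (not_lt.mp h1)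
    exact Subtype.ext (by rw [← hτ v, ← hτ v', h3])
  have hcard : 2 * (Finset.univ.image fun v : V => F (τ v)).card
      ≤ (Finset.univ.filter fun t : Fin k => F t ∈ Finset.univ.image fun v : V => F (τ v)).card := by
    refine Finset.mul_card_image_le_card_of_maps_to (f := F) (by simp) 2 ?_
    intro e he
    obtain ⟨v, -, rfl⟩ := Finset.mem_image.mp he
    obtain ⟨t', ht', h⟩ := hw (τ v) (by rw [hτ v]; exact hτ' v _ le_rfl)
    rw [← Finset.card_pair ht']
    refine Finset.card_le_card fun x hx => ?_
    simp only [Finset.mem_insert, Finset.mem_singleton] at hx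
    rcases hx with rfl | rfl
    · simp only [Finset.mem_filter, Finset.mem_univ, true_and]
      exact ⟨by rw [show F x = F (τ v) from h]; exact he, h⟩
    · simp only [Finset.mem_filter, Finset.mem_univ, true_and, and_true]
      exact he
  rw [Finset.card_image_of_injective _ hinj, Finset.card_univ, Fintype.card_coe] at hcard
  exact hcard.trans ((Finset.card_le_univ _).trans (by simp))

/-- A walk is recovered from a labelling of its times by `v + 1` labels and the vertices that carry
them; label `0` always carries `i`. -/
theorem card_walks_le (k v : ℕ) (i : n) :
    (Finset.univ.filter fun w : Fin (k + 1) → n =>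
      w 0 = i ∧ ((Finset.univ.image w).erase (w 0)).card ≤ v).card
      ≤ (v + 1) ^ (k + 1) * Fintype.card n ^ v := by
  classical
  have : (v + 1) ^ (k + 1) * Fintype.card n ^ v
      = (Finset.univ : Finset ((Fin (k + 1) → Fin (v + 1)) × (Fin v → n))).card := by
    simp
  rw [this]
  refine Finset.card_le_card_of_surjOn
    (fun p => (Fin.cons i p.2 : Fin (v + 1) → n) ∘ p.1) fun w hw => ?_
  simp only [Finset.coe_filter, Finset.mem_univ, true_and, Set.mem_ofPred_eq] at hw
  obtain ⟨h0, hc⟩ := hw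
  have hg : ∃ g : Fin v → n, ∀ x ∈ (Finset.univ.image w).erase (w 0), x ∈ Set.range g := by
    set V := (Finset.univ.image w).erase (w 0)
    let e := V.equivFin
    refine ⟨fun s => if h : (s : ℕ) < V.card then e.symm ⟨s, h⟩ else i, fun x hx => ?_⟩
    refine ⟨⟨e ⟨x, hx⟩, (e ⟨x, hx⟩).2.trans_le hc⟩, ?_⟩
    simp
  obtain ⟨g, hg⟩ := hg
  have hh : ∀ t, ∃ s, (Fin.cons i g : Fin (v + 1) → n) s = w t := by
    intro t
    by_cases ht : w t = w 0
    · exact ⟨0, by rw [ht, h0]; simp⟩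
    · obtain ⟨s, hs⟩ := hg (w t) (by simp [ht])
      exact ⟨s.succ, by simpa using hs⟩
  choose h hh using hh
  exact ⟨(h, g), by simp, funext hh⟩

end Walks

/-! ### Independent entries and expectations of powers. -/

section RandomMatrix

variable {Ω : Type*} {n : Type*}

/-- The sigma-algebra generated by the entries at the unordered pairs in `E`. -/
noncomputable abbrev pairSigma (W : Ω → Matrix n n ℂ) (E : Set (Sym2 n)) : MeasurableSpace Ω :=
  ⨆ (i : n) (j : n) (_ : s(i, j) ∈ E), MeasurableSpace.comap (fun ω => W ω i j) inferInstance

/-- A random Hermitian matrix whose entries at different unordered pairs are independent and whose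
off-diagonal entries are centred. -/
structure HasIndependentPairs [MeasurableSpace Ω] (P : Measure Ω) (W : Ω → Matrix n n ℂ) :
    Prop where
  isHermitian : ∀ ω, (W ω).IsHermitian
  measurable_entry : ∀ i j, Measurable fun ω => W ω i j
  indep : ∀ E F, Disjoint E F → Indep (pairSigma W E) (pairSigma W F) P
  mean : ∀ i j, i ≠ j → ∫ ω, W ω i j ∂P = 0

/-- The matrix with the rows and columns outside `S` replaced by zero. -/
def minor [DecidableEq n] (S : Finset n) (A : Matrix n n ℂ) : Matrix n n ℂ :=
  Matrix.of fun a b => if a ∈ S ∧ b ∈ S then A a b else 0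

theorem measurable_entry_pairSigma (W : Ω → Matrix n n ℂ) {E : Set (Sym2 n)} {i j : n}
    (h : s(i, j) ∈ E) : Measurable[pairSigma W E] fun ω => W ω i j := by
  refine Measurable.mono (comap_measurable _) ?_ le_rfl
  exact le_iSup_of_le i (le_iSup_of_le j (le_iSup_of_le h le_rfl))

theorem pairSigma_mono (W : Ω → Matrix n n ℂ) {E F : Set (Sym2 n)} (h : E ⊆ F) :
    pairSigma W E ≤ pairSigma W F :=
  iSup_le fun _ => iSup_le fun _ => iSup_le fun hij =>
    (measurable_entry_pairSigma W (h hij)).comap_le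

theorem measurable_pow_apply [Fintype n] [DecidableEq n] {m : MeasurableSpace Ω}
    {W : Ω → Matrix n n ℂ} (h : ∀ i j, Measurable[m] fun ω => W ω i j) (k : ℕ) (i j : n) :
    Measurable[m] fun ω => (W ω ^ k) i j := by
  induction k generalizing i j with
  | zero => simp
  | succ k ih =>
    simp only [pow_succ, Matrix.mul_apply]
    exact Finset.measurable_sum _ fun b _ => (ih i b).mul (h b j)

namespace HasIndependentPairs

variable [MeasurableSpace Ω] {P : Measure Ω} {W : Ω → Matrix n n ℂ}

theorem pairSigma_le (hW : HasIndependentPairs P W) (E : Set (Sym2 n)) :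
    pairSigma W E ≤ ‹MeasurableSpace Ω› :=
  iSup_le fun i => iSup_le fun j => iSup_le fun _ => (hW.measurable_entry i j).comap_le

theorem integral_mul (hW : HasIndependentPairs P W) {E F : Set (Sym2 n)} (hEF : Disjoint E F)
    {f g : Ω → ℂ} (hf : Measurable[pairSigma W E] f) (hg : Measurable[pairSigma W F] g) :
    ∫ ω, f ω * g ω ∂P = (∫ ω, f ω ∂P) * ∫ ω, g ω ∂P := by
  have hind : IndepFun f g P := by
    rw [IndepFun_iff_Indep]
    exact indep_of_indep_of_le_left (indep_of_indep_of_le_right (hW.indep E F hEF) hg.comap_le)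
      hf.comap_le
  exact hind.integral_mul_eq_mul_integral
    (hf.mono (hW.pairSigma_le E) le_rfl).aestronglyMeasurable
    (hg.mono (hW.pairSigma_le F) le_rfl).aestronglyMeasurable

/-- Independence survives any entrywise operation, which covers both minors and scaling. -/
theorem of_measurable (hW : HasIndependentPairs P W) {V : Ω → Matrix n n ℂ}
    (hV : ∀ ω, (V ω).IsHermitian)
    (hm : ∀ i j, Measurable[pairSigma W {s(i, j)}] fun ω => V ω i j)
    (h0 : ∀ i j, i ≠ j → ∫ ω, V ω i j ∂P = 0) : HasIndependentPairs P V where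
  isHermitian := hV
  measurable_entry i j := (hm i j).mono (hW.pairSigma_le _) le_rfl
  indep E F hEF := by
    have h : ∀ E, pairSigma V E ≤ pairSigma W E := fun E =>
      iSup_le fun i => iSup_le fun j => iSup_le fun hij =>
        (hm i j).comap_le.trans (pairSigma_mono W (by simpa using hij))
    exact indep_of_indep_of_le_left (indep_of_indep_of_le_right (hW.indep E F hEF) (h F)) (h E)
  mean := h0

theorem restrict [DecidableEq n] (hW : HasIndependentPairs P W) (S : Finset n) :
    HasIndependentPairs P fun ω => minor S (W ω) := by
  refine hW.of_measurable (fun ω => ?_) (fun i j => ?_) fun i j hij => ?_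
  · ext i j
    simp only [minor, Matrix.conjTranspose_apply, Matrix.of_apply, and_comm]
    split_ifs
    · exact (hW.isHermitian ω).apply i j
    · simp
  · by_cases h : i ∈ S ∧ j ∈ S
    · simpa [minor, h] using measurable_entry_pairSigma W (by simp)
    · simp [minor, h]
  · by_cases h : i ∈ S ∧ j ∈ S
    · simpa [minor, h] using hW.mean i j hij
    · simp [minor, h]

theorem smul (hW : HasIndependentPairs P W) (c : ℝ) :
    HasIndependentPairs P fun ω => c • W ω := by
  refine hW.of_measurable (fun ω => ?_) (fun i j => ?_) fun i j hij => ?_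
  · exact (hW.isHermitian ω).smul (IsSelfAdjoint.all c)
  · exact (measurable_entry_pairSigma W (by simp)).const_smul c
  · simp only [Matrix.smul_apply]
    rw [integral_smul, hW.mean i j hij, smul_zero]

end HasIndependentPairs

/-- The largest factor dominates the product; the `1` is needed for the empty product. -/
theorem prod_le_one_add_sum_pow {k : ℕ} (x : Fin k → ℝ≥0∞) : ∏ t, x t ≤ 1 + ∑ t, x t ^ k := by
  rcases k with _ | k
  · simp
  · obtain ⟨t, -, ht⟩ := Finset.exists_max_image Finset.univ x Finset.univ_nonempty
    calc ∏ t, x t ≤ x t ^ (k + 1) := by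
          simpa using Finset.prod_le_pow_card Finset.univ x (x t) ht
      _ ≤ ∑ t, x t ^ (k + 1) :=
          Finset.single_le_sum (f := fun t => x t ^ (k + 1)) (fun _ _ => zero_le) (by simp)
      _ ≤ _ := le_add_self

variable [MeasurableSpace Ω] {P : Measure Ω} [IsProbabilityMeasure P] {W : Ω → Matrix n n ℂ}

omit [IsProbabilityMeasure P] in
-- An edge crossed only once gives a centred factor independent of all the others.
theorem HasIndependentPairs.integral_walk_eq_zero (hW : HasIndependentPairs P W) {k : ℕ}
    (w : Fin (k + 1) → n) (hw : ¬ EdgesRepeated w) :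
    ∫ ω, ∏ t : Fin k, W ω (w t.castSucc) (w t.succ) ∂P = 0 := by
  simp only [EdgesRepeated, not_forall, not_exists, not_and] at hw
  obtain ⟨t, hne, ht⟩ := hw
  simp_rw [← Finset.mul_prod_erase Finset.univ _ (Finset.mem_univ t)]
  rw [hW.integral_mul (E := {s(w t.castSucc, w t.succ)}) (F := {s(w t.castSucc, w t.succ)}ᶜ)
    disjoint_compl_right, hW.mean _ _ hne, zero_mul]
  · exact measurable_entry_pairSigma W (by simp)
  · refine Finset.measurable_prod _ fun t' ht' => measurable_entry_pairSigma W ?_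
    exact ht t' (Finset.ne_of_mem_erase ht')

theorem HasIndependentPairs.lintegral_walk_le (hW : HasIndependentPairs P W) {k : ℕ}
    {C : ℝ≥0} (hC : ∀ i j, ∫⁻ ω, ‖W ω i j‖ₑ ^ k ∂P ≤ C) (w : Fin (k + 1) → n) :
    ∫⁻ ω, ‖∏ t : Fin k, W ω (w t.castSucc) (w t.succ)‖ₑ ∂P ≤ ((1 + k * C : ℝ≥0) : ℝ≥0∞) := by
  calc ∫⁻ ω, ‖∏ t : Fin k, W ω (w t.castSucc) (w t.succ)‖ₑ ∂P
      ≤ ∫⁻ ω, 1 + ∑ t : Fin k, ‖W ω (w t.castSucc) (w t.succ)‖ₑ ^ k ∂P := by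
        refine lintegral_mono fun ω => ?_
        rw [show ‖∏ t : Fin k, W ω (w t.castSucc) (w t.succ)‖ₑ
          = ∏ t : Fin k, ‖W ω (w t.castSucc) (w t.succ)‖ₑ by
            simp [enorm_eq_nnnorm, nnnorm_prod]]
        exact prod_le_one_add_sum_pow _
    _ = 1 + ∑ t : Fin k, ∫⁻ ω, ‖W ω (w t.castSucc) (w t.succ)‖ₑ ^ k ∂P := by
        rw [lintegral_add_left measurable_const, lintegral_finsetSum]
        · simp
        · exact fun t _ => (hW.measurable_entry _ _).enorm.pow_const k
    _ ≤ 1 + ∑ t : Fin k, (C : ℝ≥0∞) := by gcongr; exact hC _ _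
    _ = _ := by simp

theorem HasIndependentPairs.integrable_walk (hW : HasIndependentPairs P W) {k : ℕ}
    {C : ℝ≥0} (hC : ∀ i j, ∫⁻ ω, ‖W ω i j‖ₑ ^ k ∂P ≤ C) (w : Fin (k + 1) → n) :
    Integrable (fun ω => ∏ t : Fin k, W ω (w t.castSucc) (w t.succ)) P :=
  ⟨(Finset.measurable_prod _ fun _ _ => hW.measurable_entry _ _).aestronglyMeasurable,
    (hW.lintegral_walk_le hC w).trans_lt ENNReal.coe_lt_top⟩

variable [Fintype n] [DecidableEq n]

theorem HasIndependentPairs.integrable_pow_apply (hW : HasIndependentPairs P W) {k : ℕ}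
    {C : ℝ≥0} (hC : ∀ i j, ∫⁻ ω, ‖W ω i j‖ₑ ^ k ∂P ≤ C) (i j : n) :
    Integrable (fun ω => (W ω ^ k) i j) P := by
  simp only [pow_apply_eq_sum_walks]
  refine integrable_finsetSum _ fun w _ => ?_
  split_ifs
  · exact hW.integrable_walk hC w
  · exact integrable_zero _ _ _

/-- Only walks with repeated edges survive the expectation, and they have at most `k / 2` free
vertices; Hölder-type bounds control each one. -/
theorem HasIndependentPairs.enorm_integral_pow_apply_le (hW : HasIndependentPairs P W) {k : ℕ}
    {C : ℝ≥0} (hC : ∀ i j, ∫⁻ ω, ‖W ω i j‖ₑ ^ k ∂P ≤ C) (i : n) :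
    ‖∫ ω, (W ω ^ k) i i ∂P‖ₑ
      ≤ (((k / 2 + 1) ^ (k + 1) : ℕ) * (1 + k * C) : ℝ≥0) * (Fintype.card n : ℝ≥0∞) ^ (k / 2) := by
  classical
  simp only [pow_apply_eq_sum_walks]
  rw [integral_finsetSum]
  swap
  · intro w _
    split_ifs
    · exact hW.integrable_walk hC w
    · exact integrable_zero _ _ _
  set G := Finset.univ.filter fun w : Fin (k + 1) → n =>
      w 0 = i ∧ ((Finset.univ.image w).erase (w 0)).card ≤ k / 2 with hG
  have hterm : ∀ w : Fin (k + 1) → n, ‖∫ ω, if w 0 = i ∧ w (Fin.last k) = i then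
      ∏ t : Fin k, W ω (w t.castSucc) (w t.succ) else 0 ∂P‖ₑ
        ≤ if w ∈ G then ((1 + k * C : ℝ≥0) : ℝ≥0∞) else 0 := by
    intro w
    by_cases hw : w 0 = i ∧ w (Fin.last k) = i
    · simp only [hw, and_self, if_true]
      by_cases hr : EdgesRepeated w
      · have : w ∈ G := by
          have := card_image_le_of_edgesRepeated w hr
          simp only [hG, Finset.mem_filter, Finset.mem_univ, true_and]
          exact ⟨hw.1, by omega⟩
        simp only [this, if_true]
        exact (enorm_integral_le_lintegral_enorm _).trans (hW.lintegral_walk_le hC w)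
      · simp [hW.integral_walk_eq_zero w hr]
    · simp [hw]
  calc _ ≤ ∑ w : Fin (k + 1) → n, ‖∫ ω, if w 0 = i ∧ w (Fin.last k) = i then
      ∏ t : Fin k, W ω (w t.castSucc) (w t.succ) else 0 ∂P‖ₑ := enorm_sum_le _ _
    _ ≤ ∑ w : Fin (k + 1) → n, if w ∈ G then ((1 + k * C : ℝ≥0) : ℝ≥0∞) else 0 :=
        Finset.sum_le_sum fun w _ => hterm w
    _ = G.card * ((1 + k * C : ℝ≥0) : ℝ≥0∞) := by
        rw [← Finset.sum_filter, Finset.sum_const, Finset.filter_mem_eq_inter, Finset.univ_inter,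
          nsmul_eq_mul]
    _ ≤ ((k / 2 + 1) ^ (k + 1) * Fintype.card n ^ (k / 2) : ℕ) * ((1 + k * C : ℝ≥0) : ℝ≥0∞) := by
        gcongr
        exact card_walks_le k (k / 2) i
    _ ≤ _ := by
        push_cast
        rw [mul_right_comm]

end RandomMatrix

/-! ### Diagonal entries of powers of Hermitian matrices. -/

section Hermitian

variable {n : Type*} [Fintype n] [DecidableEq n] {A : Matrix n n ℂ}

theorem pow_two_mul_apply_self (hA : A.IsHermitian) (k : ℕ) (i : n) :
    (A ^ (2 * k)) i i = ((∑ j, ‖(A ^ k) i j‖ ^ 2 : ℝ) : ℂ) := by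
  rw [two_mul, pow_add, Matrix.mul_apply]
  push_cast
  refine Finset.sum_congr rfl fun j _ => ?_
  rw [← (hA.pow k).apply j i, ← Complex.mul_conj']
  rfl

theorem norm_pow_two_mul_apply_self (hA : A.IsHermitian) (k : ℕ) (i : n) :
    ‖(A ^ (2 * k)) i i‖ = ∑ j, ‖(A ^ k) i j‖ ^ 2 := by
  rw [pow_two_mul_apply_self hA, Complex.norm_real, Real.norm_of_nonneg (by positivity)]

theorem norm_pow_apply_sq_le (hA : A.IsHermitian) (k : ℕ) (i : n) :
    ‖(A ^ k) i i‖ ^ 2 ≤ ‖(A ^ (2 * k)) i i‖ := by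
  rw [norm_pow_two_mul_apply_self hA]
  exact Finset.single_le_sum (f := fun j => ‖(A ^ k) i j‖ ^ 2) (fun _ _ => by positivity)
    (Finset.mem_univ i)

/-- Iterating the squared bound trades a high moment of an entry for the first moment of an entry of
a higher power. -/
theorem norm_pow_apply_two_pow_le (hA : A.IsHermitian) (k q : ℕ) (i : n) :
    ‖(A ^ k) i i‖ ^ 2 ^ q ≤ ‖(A ^ (2 ^ q * k)) i i‖ := by
  induction q with
  | zero => simp
  | succ q ih =>
    rw [pow_succ, pow_mul, show 2 ^ q * 2 * k = 2 * (2 ^ q * k) by ring]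
    exact (pow_le_pow_left₀ (by positivity) ih 2).trans (norm_pow_apply_sq_le hA _ i)

end Hermitian

section RandomMatrix

variable {Ω : Type*} {n : Type*} [Fintype n] [DecidableEq n]
  [MeasurableSpace Ω] {P : Measure Ω} [IsProbabilityMeasure P] {W : Ω → Matrix n n ℂ}

/-- Diagonal entries of even powers are nonnegative, so their absolute mean is the modulus of their
mean, where the cancellation between walks is available. -/
theorem HasIndependentPairs.lintegral_pow_apply_le (hW : HasIndependentPairs P W) (k q : ℕ) {C : ℝ≥0}
    (hC : ∀ i j, ∫⁻ ω, ‖W ω i j‖ₑ ^ (2 * (2 ^ q * k)) ∂P ≤ C) (i : n) :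
    ∫⁻ ω, ‖(W ω ^ k) i i‖ₑ ^ 2 ^ (q + 1) ∂P
      ≤ (((2 ^ q * k + 1) ^ (2 * (2 ^ q * k) + 1) : ℕ) * (1 + (2 * (2 ^ q * k) : ℕ) * C) : ℝ≥0)
        * (Fintype.card n : ℝ≥0∞) ^ (2 ^ q * k) := by
  have hint := hW.integrable_pow_apply hC i i
  calc ∫⁻ ω, ‖(W ω ^ k) i i‖ₑ ^ 2 ^ (q + 1) ∂P
      ≤ ∫⁻ ω, ‖(W ω ^ (2 * (2 ^ q * k))) i i‖ₑ ∂P := by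
        refine lintegral_mono fun ω => ?_
        have := norm_pow_apply_two_pow_le (hW.isHermitian ω) k (q + 1) i
        rw [show 2 ^ (q + 1) * k = 2 * (2 ^ q * k) by ring] at this
        rw [← enorm_pow]
        exact enorm_le_iff_norm_le.mpr (by rwa [norm_pow])
    _ = ‖∫ ω, (W ω ^ (2 * (2 ^ q * k))) i i ∂P‖ₑ := by
        have h : ∀ ω, (W ω ^ (2 * (2 ^ q * k))) i i
            = ((‖(W ω ^ (2 * (2 ^ q * k))) i i‖ : ℝ) : ℂ) := fun ω => by
          rw [norm_pow_two_mul_apply_self (hW.isHermitian ω),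
            pow_two_mul_apply_self (hW.isHermitian ω)]
        rw [← ofReal_integral_norm_eq_lintegral_enorm hint]
        conv_rhs => rw [integral_congr_ae (Eventually.of_forall h), integral_complex_ofReal]
        rw [← ofReal_norm, Complex.norm_real, Real.norm_of_nonneg (by positivity)]
    _ ≤ _ := by
        refine (hW.enorm_integral_pow_apply_le hC i).trans_eq ?_
        rw [show 2 * (2 ^ q * k) / 2 = 2 ^ q * k by omega]

end RandomMatrix

/-! ### Elementary inequalities for moments. -/

theorem ennreal_add_pow_le (x y : ℝ≥0∞) (p : ℕ) : (x + y) ^ p ≤ 2 ^ p * (x ^ p + y ^ p) := by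
  rcases le_total x y with h | h
  · calc (x + y) ^ p ≤ (2 * y) ^ p := by rw [two_mul]; gcongr
      _ = 2 ^ p * y ^ p := mul_pow _ _ _
      _ ≤ _ := by gcongr; exact le_add_self
  · calc (x + y) ^ p ≤ (2 * x) ^ p := by rw [two_mul]; gcongr
      _ = 2 ^ p * x ^ p := mul_pow _ _ _
      _ ≤ _ := by gcongr; exact le_self_add

theorem ennreal_mul_pow_le (x y : ℝ≥0∞) (p : ℕ) :
    (x * y) ^ p ≤ x ^ (2 * p) + y ^ (2 * p) := by
  rcases le_total x y with h | h
  · calc (x * y) ^ p ≤ (y * y) ^ p := by gcongr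
      _ = y ^ (2 * p) := by rw [← sq, ← pow_mul]
      _ ≤ _ := le_add_self
  · calc (x * y) ^ p ≤ (x * x) ^ p := by gcongr
      _ = x ^ (2 * p) := by rw [← sq, ← pow_mul]
      _ ≤ _ := le_self_add

theorem ennreal_pow_le_one_add (x : ℝ≥0∞) {p q : ℕ} (h : p ≤ q) : x ^ p ≤ 1 + x ^ q := by
  rcases le_total x 1 with hx | hx
  · exact (pow_le_one₀ zero_le hx).trans le_self_add
  · exact (pow_le_pow_right₀ hx h).trans le_add_self

theorem ennreal_sq_le_add_div (y : ℝ≥0∞) {K : ℝ≥0∞} (h0 : K ≠ 0) (h1 : K ≠ ⊤) :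
    y ^ 2 ≤ K + y ^ 4 / K := by
  rcases le_total (y ^ 2) K with h | h
  · exact h.trans le_self_add
  · refine le_trans ?_ le_add_self
    rw [ENNReal.le_div_iff_mul_le (.inl h0) (.inl h1)]
    calc y ^ 2 * K ≤ y ^ 2 * y ^ 2 := by gcongr
      _ = y ^ 4 := by ring

theorem enorm_integral_sq_le {Ω : Type*} [MeasurableSpace Ω] {P : Measure Ω}
    [IsProbabilityMeasure P] {f : Ω → ℂ} (hf : AEStronglyMeasurable f P) :
    ‖∫ ω, f ω ∂P‖ₑ ^ 2 ≤ ∫⁻ ω, ‖f ω‖ₑ ^ 2 ∂P := by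
  have h := eLpNorm_le_eLpNorm_of_exponent_le (p := 1) (q := 2) (by norm_num) hf
  rw [eLpNorm_one_eq_lintegral_enorm] at h
  have h2 : eLpNorm f 2 P ^ 2 = ∫⁻ ω, ‖f ω‖ₑ ^ 2 ∂P := by
    have := eLpNorm_nnreal_pow_eq_lintegral (p := 2) (μ := P) (f := f) (by norm_num)
    simpa using this
  rw [← h2]
  exact pow_le_pow_left₀ zero_le ((enorm_integral_le_lintegral_enorm f).trans h) 2

theorem lintegral_enorm_sum_sq_le {Ω κ : Type*} [MeasurableSpace Ω] {P : Measure Ω}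
    {T : Finset κ} {x : κ → Ω → ℂ} (hx : ∀ a ∈ T, Measurable (x a)) {ε : ℝ≥0∞}
    (h : ∀ a ∈ T, ∫⁻ ω, ‖x a ω‖ₑ ^ 2 ∂P ≤ ε) :
    ∫⁻ ω, ‖∑ a ∈ T, x a ω‖ₑ ^ 2 ∂P ≤ (T.card : ℝ≥0∞) ^ 2 * ε := by
  calc ∫⁻ ω, ‖∑ a ∈ T, x a ω‖ₑ ^ 2 ∂P
      ≤ ∫⁻ ω, T.card * ∑ a ∈ T, ‖x a ω‖ₑ ^ 2 ∂P := by
        refine lintegral_mono fun ω => ?_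
        refine (pow_le_pow_left₀ zero_le (enorm_sum_le _ _) 2).trans ?_
        have := ENNReal.rpow_sum_le_const_mul_sum_rpow T (fun a => ‖x a ω‖ₑ) (p := 2) (by norm_num)
        norm_num at this
        exact_mod_cast this
    _ = T.card * ∑ a ∈ T, ∫⁻ ω, ‖x a ω‖ₑ ^ 2 ∂P := by
        rw [lintegral_const_mul' _ _ (by simp), lintegral_finsetSum']
        exact fun a ha => ((hx a ha).enorm.pow_const 2).aemeasurable
    _ ≤ T.card * ∑ a ∈ T, ε := by gcongr with a ha; exact h a ha
    _ = _ := by rw [Finset.sum_const, nsmul_eq_mul]; ring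

/-! ### Calculus of `L²` limits with bounded moments. -/

section Families

variable {ι : Type*} {Ω : ι → Type*} [∀ i, MeasurableSpace (Ω i)] {P : ∀ i, Measure (Ω i)}

/-- A family of complex random variables whose absolute moments are uniformly bounded. -/
structure BoundedMoments (P : ∀ i, Measure (Ω i)) (f : ∀ i, Ω i → ℂ) : Prop where
  measurable : ∀ i, Measurable (f i)
  bound : ∀ p : ℕ, ∃ C : ℝ≥0, ∀ i, ∫⁻ ω, ‖f i ω‖ₑ ^ p ∂P i ≤ C

/-- A family with bounded moments that tends to zero in `L²`. -/
structure TendsToZero (l : Filter ι) (P : ∀ i, Measure (Ω i)) (f : ∀ i, Ω i → ℂ) : Prop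
    extends BoundedMoments P f where
  tendsto : Tendsto (fun i => ∫⁻ ω, ‖f i ω‖ₑ ^ 2 ∂P i) l (𝓝 0)

/-- A family with bounded moments that tends to the constant `c` in `L²`. -/
def TendsToConst (l : Filter ι) (P : ∀ i, Measure (Ω i)) (f : ∀ i, Ω i → ℂ) (c : ℂ) : Prop :=
  TendsToZero l P fun i ω => f i ω - c

variable {l : Filter ι} {f g : ∀ i, Ω i → ℂ} {c d : ℂ}

namespace BoundedMoments

theorem of_two_pow [∀ i, IsProbabilityMeasure (P i)] (hm : ∀ i, Measurable (f i))
    (h : ∀ q : ℕ, ∃ C : ℝ≥0, ∀ i, ∫⁻ ω, ‖f i ω‖ₑ ^ 2 ^ (q + 1) ∂P i ≤ C) :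
    BoundedMoments P f := by
  refine ⟨hm, fun p => ?_⟩
  obtain ⟨C, hC⟩ := h p
  refine ⟨1 + C, fun i => ?_⟩
  calc ∫⁻ ω, ‖f i ω‖ₑ ^ p ∂P i ≤ ∫⁻ ω, 1 + ‖f i ω‖ₑ ^ 2 ^ (p + 1) ∂P i :=
        lintegral_mono fun ω => ennreal_pow_le_one_add _
          ((Nat.lt_two_pow_self (n := p)).le.trans (Nat.pow_le_pow_right two_pos (by omega)))
    _ = 1 + ∫⁻ ω, ‖f i ω‖ₑ ^ 2 ^ (p + 1) ∂P i := by
        rw [lintegral_add_left measurable_const]; simp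
    _ ≤ _ := by push_cast; gcongr; exact hC i

theorem const [∀ i, IsProbabilityMeasure (P i)] {c : ι → ℂ} {C : ℝ≥0} (h : ∀ i, ‖c i‖₊ ≤ C) :
    BoundedMoments P fun i _ => c i := by
  refine ⟨fun i => measurable_const, fun p => ⟨C ^ p, fun i => ?_⟩⟩
  simp only [lintegral_const, measure_univ, mul_one]
  push_cast
  gcongr
  exact_mod_cast h i

theorem add (hf : BoundedMoments P f) (hg : BoundedMoments P g) :
    BoundedMoments P fun i ω => f i ω + g i ω := by
  refine ⟨fun i => (hf.measurable i).add (hg.measurable i), fun p => ?_⟩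
  obtain ⟨C, hC⟩ := hf.bound p
  obtain ⟨D, hD⟩ := hg.bound p
  refine ⟨2 ^ p * (C + D), fun i => ?_⟩
  calc ∫⁻ ω, ‖f i ω + g i ω‖ₑ ^ p ∂P i
      ≤ ∫⁻ ω, 2 ^ p * (‖f i ω‖ₑ ^ p + ‖g i ω‖ₑ ^ p) ∂P i := lintegral_mono fun ω =>
        (pow_le_pow_left₀ zero_le (enorm_add_le _ _) p).trans (ennreal_add_pow_le _ _ p)
    _ = 2 ^ p * (∫⁻ ω, ‖f i ω‖ₑ ^ p ∂P i + ∫⁻ ω, ‖g i ω‖ₑ ^ p ∂P i) := by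
        rw [lintegral_const_mul' _ _ (by simp),
          lintegral_add_left ((hf.measurable i).enorm.pow_const p)]
    _ ≤ _ := by push_cast; gcongr; exacts [hC i, hD i]

theorem mul (hf : BoundedMoments P f) (hg : BoundedMoments P g) :
    BoundedMoments P fun i ω => f i ω * g i ω := by
  refine ⟨fun i => (hf.measurable i).mul (hg.measurable i), fun p => ?_⟩
  obtain ⟨C, hC⟩ := hf.bound (2 * p)
  obtain ⟨D, hD⟩ := hg.bound (2 * p)
  refine ⟨C + D, fun i => ?_⟩
  calc ∫⁻ ω, ‖f i ω * g i ω‖ₑ ^ p ∂P i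
      ≤ ∫⁻ ω, ‖f i ω‖ₑ ^ (2 * p) + ‖g i ω‖ₑ ^ (2 * p) ∂P i := lintegral_mono fun ω => by
        rw [enorm_mul]; exact ennreal_mul_pow_le _ _ p
    _ = ∫⁻ ω, ‖f i ω‖ₑ ^ (2 * p) ∂P i + ∫⁻ ω, ‖g i ω‖ₑ ^ (2 * p) ∂P i :=
        lintegral_add_left ((hf.measurable i).enorm.pow_const _) _
    _ ≤ _ := by push_cast; gcongr; exacts [hC i, hD i]

theorem neg (hf : BoundedMoments P f) : BoundedMoments P fun i ω => - f i ω :=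
  ⟨fun i => (hf.measurable i).neg, by simpa only [enorm_neg] using hf.bound⟩

theorem sub (hf : BoundedMoments P f) (hg : BoundedMoments P g) :
    BoundedMoments P fun i ω => f i ω - g i ω := by
  simpa only [sub_eq_add_neg] using hf.add hg.neg

theorem finsetSum [∀ i, IsProbabilityMeasure (P i)] {κ : Type*} (s : Finset κ)
    {f : κ → ∀ i, Ω i → ℂ} (hf : ∀ a ∈ s, BoundedMoments P (f a)) :
    BoundedMoments P fun i ω => ∑ a ∈ s, f a i ω := by
  classical
  induction s using Finset.induction_on with
  | empty => simpa using const (P := P) (c := fun _ => 0) (C := 0) (by simp)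
  | insert a s ha ih =>
    simp only [Finset.sum_insert ha]
    exact (hf a (by simp)).add (ih fun b hb => hf b (by simp [hb]))

end BoundedMoments

theorem tendsto_lintegral_add_sq (hm : ∀ i, Measurable (f i))
    (hf : Tendsto (fun i => ∫⁻ ω, ‖f i ω‖ₑ ^ 2 ∂P i) l (𝓝 0))
    (hg : Tendsto (fun i => ∫⁻ ω, ‖g i ω‖ₑ ^ 2 ∂P i) l (𝓝 0)) :
    Tendsto (fun i => ∫⁻ ω, ‖f i ω + g i ω‖ₑ ^ 2 ∂P i) l (𝓝 0) := by
  have h : Tendsto (fun i => 2 ^ 2 * (∫⁻ ω, ‖f i ω‖ₑ ^ 2 ∂P i + ∫⁻ ω, ‖g i ω‖ₑ ^ 2 ∂P i)) l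
      (𝓝 (2 ^ 2 * (0 + 0))) :=
    ENNReal.Tendsto.const_mul (hf.add hg) (.inr (by simp))
  rw [add_zero, mul_zero] at h
  refine tendsto_of_tendsto_of_tendsto_of_le_of_le tendsto_const_nhds h (fun _ => zero_le)
    fun i => ?_
  simp only
  rw [← lintegral_add_left ((hm i).enorm.pow_const 2), ← lintegral_const_mul' _ _ (by simp)]
  exact lintegral_mono fun ω =>
    (pow_le_pow_left₀ zero_le (enorm_add_le _ _) 2).trans (ennreal_add_pow_le _ _ 2)

namespace TendsToZero

theorem add (hf : TendsToZero l P f) (hg : TendsToZero l P g) :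
    TendsToZero l P fun i ω => f i ω + g i ω :=
  ⟨hf.toBoundedMoments.add hg.toBoundedMoments,
    tendsto_lintegral_add_sq hf.measurable hf.tendsto hg.tendsto⟩

/-- Since `g` need not be bounded, `|g|²` is split as at most `K + |g|⁴ / K`: the first part is
small because `f` is, the second because `f * g * g` has bounded second moment. First `K` is chosen,
then the index. -/
theorem mul (hf : TendsToZero l P f) (hg : BoundedMoments P g) :
    TendsToZero l P fun i ω => f i ω * g i ω := by
  refine ⟨hf.toBoundedMoments.mul hg, ?_⟩
  obtain ⟨C, hC⟩ := ((hf.toBoundedMoments.mul hg).mul hg).bound 2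
  have key : ∀ K : ℕ, K ≠ 0 → ∀ᶠ i in l,
      ∫⁻ ω, ‖f i ω * g i ω‖ₑ ^ 2 ∂P i ≤ (1 + C) / (K : ℝ≥0∞) := by
    intro K hK
    have hK0 : (K : ℝ≥0∞) ≠ 0 := by exact_mod_cast hK
    have hε : (0 : ℝ≥0∞) < 1 / K / K := by simp [ENNReal.div_pos_iff]
    filter_upwards [(ENNReal.tendsto_nhds_zero.mp hf.tendsto) _ hε] with i hi
    calc ∫⁻ ω, ‖f i ω * g i ω‖ₑ ^ 2 ∂P i
        ≤ ∫⁻ ω, K * ‖f i ω‖ₑ ^ 2 + (K : ℝ≥0∞)⁻¹ * ‖f i ω * g i ω * g i ω‖ₑ ^ 2 ∂P i := by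
          refine lintegral_mono fun ω => ?_
          simp only [enorm_mul, mul_pow]
          calc ‖f i ω‖ₑ ^ 2 * ‖g i ω‖ₑ ^ 2
              ≤ ‖f i ω‖ₑ ^ 2 * (K + ‖g i ω‖ₑ ^ 4 / K) := by
                gcongr
                exact ennreal_sq_le_add_div _ hK0 (by simp)
            _ = _ := by rw [div_eq_mul_inv]; ring
      _ = K * ∫⁻ ω, ‖f i ω‖ₑ ^ 2 ∂P i
          + (K : ℝ≥0∞)⁻¹ * ∫⁻ ω, ‖f i ω * g i ω * g i ω‖ₑ ^ 2 ∂P i := by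
          rw [lintegral_add_left (((hf.measurable i).enorm.pow_const 2).const_mul _),
            lintegral_const_mul' _ _ (by simp), lintegral_const_mul' _ _ (by simp [hK])]
      _ ≤ K * (1 / K / K) + (K : ℝ≥0∞)⁻¹ * C := by gcongr; exact hC i
      _ = (1 + C) / (K : ℝ≥0∞) := by
          rw [ENNReal.mul_div_cancel hK0 (by simp), ENNReal.add_div, div_eq_mul_inv (C : ℝ≥0∞),
            mul_comm (C : ℝ≥0∞)]
  rw [ENNReal.tendsto_nhds_zero]
  intro ε hε
  have hlim : Tendsto (fun K : ℕ => (1 + C) / (K : ℝ≥0∞)) atTop (𝓝 0) :=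
    ENNReal.Tendsto.const_div ENNReal.tendsto_nat_nhds_top (.inr (by simp)) |>.trans (by simp)
  obtain ⟨K, hK, hK0⟩ := (((ENNReal.tendsto_nhds_zero.mp hlim) ε hε).and
    (eventually_ne_atTop 0)).exists
  filter_upwards [key K hK0] with i hi using hi.trans hK

theorem const [∀ i, IsProbabilityMeasure (P i)] {c : ι → ℂ} {C : ℝ≥0} (h : ∀ i, ‖c i‖₊ ≤ C)
    (hc : Tendsto c l (𝓝 0)) : TendsToZero l P fun i _ => c i := by
  refine ⟨BoundedMoments.const h, ?_⟩
  simp only [lintegral_const, measure_univ, mul_one]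
  have := (ENNReal.continuous_pow 2).tendsto _ |>.comp
    ((continuous_enorm.tendsto (0 : ℂ)).comp hc)
  simpa [Function.comp_def] using this

end TendsToZero

namespace TendsToConst

theorem const [∀ i, IsProbabilityMeasure (P i)] (c : ℂ) : TendsToConst l P (fun _ _ => c) c := by
  simpa [TendsToConst] using TendsToZero.const (P := P) (l := l) (c := fun _ => 0) (C := 0)
    (by simp) tendsto_const_nhds

theorem boundedMoments [∀ i, IsProbabilityMeasure (P i)] (hf : TendsToConst l P f c) :
    BoundedMoments P f := by
  have := hf.toBoundedMoments.add (BoundedMoments.const (P := P) (c := fun _ => c) fun _ => le_rfl)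
  simpa using this

theorem add (hf : TendsToConst l P f c) (hg : TendsToConst l P g d) :
    TendsToConst l P (fun i ω => f i ω + g i ω) (c + d) := by
  have := TendsToZero.add hf hg
  unfold TendsToConst
  convert this using 3
  ring

theorem mul [∀ i, IsProbabilityMeasure (P i)] (hf : TendsToConst l P f c)
    (hg : TendsToConst l P g d) : TendsToConst l P (fun i ω => f i ω * g i ω) (c * d) := by
  -- `f * g - c * d = (f - c) * g + (g - d) * c`.
  have := (TendsToZero.mul hf hg.boundedMoments).add
    (TendsToZero.mul hg (BoundedMoments.const (P := P) (c := fun _ => c) fun _ => le_rfl))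
  unfold TendsToConst
  convert this using 3
  ring

theorem finsetSum [∀ i, IsProbabilityMeasure (P i)] {κ : Type*} (s : Finset κ)
    {f : κ → ∀ i, Ω i → ℂ} {c : κ → ℂ} (hf : ∀ a ∈ s, TendsToConst l P (f a) (c a)) :
    TendsToConst l P (fun i ω => ∑ a ∈ s, f a i ω) (∑ a ∈ s, c a) := by
  classical
  induction s using Finset.induction_on with
  | empty => simpa using const 0
  | insert a s ha ih =>
    simp only [Finset.sum_insert ha]
    exact (hf a (by simp)).add (ih fun b hb => hf b (by simp [hb]))

end TendsToConst

end Families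

/-! ### First-return decomposition of closed walks. -/

section FirstReturn

variable {n : Type*} [Fintype n] [DecidableEq n]

theorem sum_minor_mul {S : Finset n} (A : Matrix n n ℂ) {a : n} (ha : a ∈ S) (g : n → ℂ) :
    ∑ c, minor S A a c * g c = ∑ c ∈ S, A a c * g c := by
  simp only [minor, Matrix.of_apply, ha, true_and, ite_mul, zero_mul]
  rw [← Finset.sum_filter, Finset.filter_mem_eq_inter, Finset.univ_inter]

theorem minor_pow_succ_apply {S : Finset n} (A : Matrix n n ℂ) {a : n} (ha : a ∈ S) (k : ℕ)
    (b : n) : (minor S A ^ (k + 1)) a b = ∑ c ∈ S, A a c * (minor S A ^ k) c b := by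
  rw [pow_succ', Matrix.mul_apply, sum_minor_mul A ha]

/-- The weight of the excursions of `r + 2` steps from `i` inside `S` that return to `i` only at
the end. -/
def excursion (S : Finset n) (i : n) (r : ℕ) (A : Matrix n n ℂ) : ℂ :=
  ∑ e ∈ S.erase i ×ˢ S.erase i, A i e.1 * (minor (S.erase i) A ^ r) e.1 e.2 * A e.2 i

/-- A walk from `a` to `i` is cut at its first visit to `i`: it avoids `i` for `p.1` steps, steps to
`i`, and then closes up in `p.2` steps. -/
theorem minor_pow_apply_column {S : Finset n} (A : Matrix n n ℂ) {i : n} (hi : i ∈ S) (k : ℕ)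
    {a : n} (ha : a ∈ S.erase i) :
    (minor S A ^ (k + 1)) a i = ∑ p ∈ antidiagonal k,
      (∑ b ∈ S.erase i, (minor (S.erase i) A ^ p.1) a b * A b i) * (minor S A ^ p.2) i i := by
  have haS : a ∈ S := Finset.mem_of_mem_erase ha
  induction k generalizing a with
  | zero =>
    have hab : ∀ b, (1 : Matrix n n ℂ) a b * A b i = if a = b then A b i else 0 := fun b => by
      simp [Matrix.one_apply]
    simp [hab, minor, haS, hi, (Finset.ne_of_mem_erase ha)]
  | succ k ih =>
    rw [minor_pow_succ_apply A haS, ← Finset.add_sum_erase S _ hi,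
      Finset.Nat.sum_antidiagonal_succ]
    congr 1
    · have hab : ∀ b, (1 : Matrix n n ℂ) a b * A b i = if a = b then A b i else 0 := fun b => by
        simp [Matrix.one_apply]
      simp [hab, haS, (Finset.ne_of_mem_erase ha)]
    · rw [Finset.sum_congr rfl fun c hc => by rw [ih hc (Finset.mem_of_mem_erase hc)]]
      simp only [minor_pow_succ_apply A ha, Finset.mul_sum, Finset.sum_mul]
      rw [Finset.sum_comm]
      refine Finset.sum_congr rfl fun p _ => ?_
      rw [Finset.sum_comm]
      exact Finset.sum_congr rfl fun b _ => Finset.sum_congr rfl fun c _ => by ring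

theorem minor_pow_one_apply {S : Finset n} (A : Matrix n n ℂ) {i : n} (hi : i ∈ S) :
    (minor S A ^ 1) i i = A i i := by
  simp [minor, hi]

/-- Decomposition of closed walks at their first return. -/
theorem minor_pow_apply_self {S : Finset n} (A : Matrix n n ℂ) {i : n} (hi : i ∈ S) (k : ℕ) :
    (minor S A ^ (k + 2)) i i = A i i * (minor S A ^ (k + 1)) i i +
      ∑ p ∈ antidiagonal k, excursion S i p.1 A * (minor S A ^ p.2) i i := by
  rw [minor_pow_succ_apply A hi, ← Finset.add_sum_erase S _ hi]
  congr 1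
  rw [Finset.sum_congr rfl fun c hc => by rw [minor_pow_apply_column A hi k hc]]
  simp only [excursion, Finset.sum_product, Finset.mul_sum, Finset.sum_mul]
  rw [Finset.sum_comm]
  refine Finset.sum_congr rfl fun p _ => ?_
  exact Finset.sum_congr rfl fun b _ => Finset.sum_congr rfl fun c _ => by ring

end FirstReturn

/-! ### Concentration of quadratic forms in a row. -/

section QuadraticForm

variable {Ω : Type*} {n : Type*} [MeasurableSpace Ω] {P : Measure Ω} {W : Ω → Matrix n n ℂ}

theorem HasIndependentPairs.integrable_mul (hW : HasIndependentPairs P W) {E F : Set (Sym2 n)}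
    (hEF : Disjoint E F) {f g : Ω → ℂ} (hf : Measurable[pairSigma W E] f)
    (hg : Measurable[pairSigma W F] g) (hf' : Integrable f P) (hg' : Integrable g P) :
    Integrable (fun ω => f ω * g ω) P := by
  have hind : IndepFun f g P := by
    rw [IndepFun_iff_Indep]
    exact indep_of_indep_of_le_left (indep_of_indep_of_le_right (hW.indep E F hEF) hg.comap_le)
      hf.comap_le
  exact hind.integrable_mul hf' hg'

theorem lintegral_enorm_mul_le {f g : Ω → ℂ} (hf : Measurable f) :
    ∫⁻ ω, ‖f ω * g ω‖ₑ ∂P ≤ ∫⁻ ω, ‖f ω‖ₑ ^ 2 ∂P + ∫⁻ ω, ‖g ω‖ₑ ^ 2 ∂P := by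
  rw [← lintegral_add_left (hf.enorm.pow_const 2)]
  refine lintegral_mono fun ω => ?_
  simpa [enorm_mul] using ennreal_mul_pow_le ‖f ω‖ₑ ‖g ω‖ₑ 1

variable [DecidableEq n]

/-- The centred product of the entries of row and column `i` at `a` and `b`. -/
def centredProduct (W : Ω → Matrix n n ℂ) (v : ℝ) (i a b : n) (ω : Ω) : ℂ :=
  W ω i a * W ω b i - if a = b then (v : ℂ) else 0

omit [MeasurableSpace Ω] in
theorem measurable_centredProduct (W : Ω → Matrix n n ℂ) (v : ℝ) (i a b : n) :
    Measurable[pairSigma W {s(i, a), s(i, b)}] (centredProduct W v i a b) := by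
  refine Measurable.sub (Measurable.mul ?_ ?_) measurable_const
  · exact measurable_entry_pairSigma W (by simp)
  · exact measurable_entry_pairSigma W (by simp [Sym2.eq_swap])

variable {i : n} {v : ℝ} {κ : ℝ≥0}

theorem HasIndependentPairs.star_centredProduct (hW : HasIndependentPairs P W) (a b : n) (ω : Ω) :
    star (centredProduct W v i a b ω) = centredProduct W v i b a ω := by
  have h : ∀ x y, star (W ω x y) = W ω y x := fun x y => (hW.isHermitian ω).apply y x
  simp only [centredProduct, star_sub, star_mul', h, eq_comm (a := a)]
  split_ifs <;> simp [mul_comm]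

variable [IsProbabilityMeasure P]

theorem HasIndependentPairs.lintegral_centredProduct_le (hW : HasIndependentPairs P W)
    (hκ : ∀ a b, ∫⁻ ω, ‖W ω a b‖ₑ ^ 4 ∂P ≤ κ) (hv : ∀ a ≠ i, ∫ ω, W ω i a * W ω a i ∂P = v)
    {a : n} (b : n) (ha : a ≠ i) :
    ∫⁻ ω, ‖centredProduct W v i a b ω‖ₑ ^ 2 ∂P ≤ 16 * κ := by
  have h1 : ∀ c, ∫⁻ ω, ‖W ω i a * W ω c i‖ₑ ^ 2 ∂P ≤ 2 * κ := by
    intro c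
    calc ∫⁻ ω, ‖W ω i a * W ω c i‖ₑ ^ 2 ∂P
        ≤ ∫⁻ ω, ‖W ω i a‖ₑ ^ 4 + ‖W ω c i‖ₑ ^ 4 ∂P := lintegral_mono fun ω => by
          rw [enorm_mul]; exact ennreal_mul_pow_le _ _ 2
      _ = ∫⁻ ω, ‖W ω i a‖ₑ ^ 4 ∂P + ∫⁻ ω, ‖W ω c i‖ₑ ^ 4 ∂P :=
          lintegral_add_left ((hW.measurable_entry i a).enorm.pow_const 4) _
      _ ≤ κ + κ := by gcongr <;> exact hκ _ _
      _ = 2 * κ := (two_mul _).symm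
  have h2 : ‖(v : ℂ)‖ₑ ^ 2 ≤ 2 * κ := by
    rw [← hv a ha]
    exact (enorm_integral_sq_le ((hW.measurable_entry i a).mul
      (hW.measurable_entry a i)).aestronglyMeasurable).trans (h1 a)
  have h3 : ‖(if a = b then (v : ℂ) else 0)‖ₑ ^ 2 ≤ 2 * κ := by
    split_ifs
    · exact h2
    · simp
  calc ∫⁻ ω, ‖centredProduct W v i a b ω‖ₑ ^ 2 ∂P
      ≤ ∫⁻ ω, 2 ^ 2 * (‖W ω i a * W ω b i‖ₑ ^ 2 + ‖(if a = b then (v : ℂ) else 0)‖ₑ ^ 2) ∂P :=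
        lintegral_mono fun ω =>
          (pow_le_pow_left₀ zero_le enorm_sub_le 2).trans (ennreal_add_pow_le _ _ 2)
    _ = 2 ^ 2 * (∫⁻ ω, ‖W ω i a * W ω b i‖ₑ ^ 2 ∂P + ‖(if a = b then (v : ℂ) else 0)‖ₑ ^ 2) := by
        rw [lintegral_const_mul' _ _ (by simp), lintegral_add_right _ measurable_const]
        simp only [lintegral_const, measure_univ, mul_one]
    _ ≤ 2 ^ 2 * (2 * κ + 2 * κ) := by gcongr; exact h1 b
    _ = 16 * κ := by ring

/-- An index of the first pair missing from the second gives a centred independent factor: a single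
entry if `a ≠ b`, the whole centred product if `a = b`. -/
theorem HasIndependentPairs.integral_centredProduct_mul_of_ne (hW : HasIndependentPairs P W)
    (hκ : ∀ a b, ∫⁻ ω, ‖W ω a b‖ₑ ^ 4 ∂P ≤ κ) (hv : ∀ a ≠ i, ∫ ω, W ω i a * W ω a i ∂P = v)
    {a b c d : n} (ha : a ≠ i) (hb : b ≠ i)
    (h : (a ≠ c ∧ a ≠ d) ∨ (b ≠ c ∧ b ≠ d)) :
    ∫ ω, centredProduct W v i a b ω * centredProduct W v i c d ω ∂P = 0 := by
  have hs : ∀ x y, s(i, x) = s(i, y) ↔ x = y := fun x y => Sym2.congr_right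
  have hmeas : Measurable[pairSigma W {s(i, c), s(i, d)}] (centredProduct W v i c d) :=
    measurable_centredProduct W v i c d
  by_cases hab : a = b
  · subst hab
    have hne : a ≠ c ∧ a ≠ d := by tauto
    rw [hW.integral_mul (E := {s(i, a), s(i, a)}) (F := {s(i, c), s(i, d)}) ?_
      (measurable_centredProduct W v i a a) hmeas]
    · suffices ∫ ω, centredProduct W v i a a ω ∂P = 0 by rw [this, zero_mul]
      simp only [centredProduct, if_true]
      rw [integral_sub _ (integrable_const _), hv a ha]
      · simp
      · refine ⟨((hW.measurable_entry i a).mul (hW.measurable_entry a i)).aestronglyMeasurable, ?_⟩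
        refine lt_of_le_of_lt (lintegral_enorm_mul_le (hW.measurable_entry i a)) ?_
        have hfin : ∀ x y, ∫⁻ ω, ‖W ω x y‖ₑ ^ 2 ∂P < ⊤ := fun x y => by
          refine lt_of_le_of_lt (lintegral_mono fun ω =>
            ennreal_pow_le_one_add ‖W ω x y‖ₑ (show 2 ≤ 4 by norm_num)) ?_
          rw [lintegral_add_left measurable_const]
          simpa using (hκ x y).trans_lt ENNReal.coe_lt_top
        exact ENNReal.add_lt_top.mpr ⟨hfin _ _, hfin _ _⟩
    · simp [hs, hne]
  · have hsplit : ∀ ω, centredProduct W v i a b ω = W ω i a * W ω b i := fun ω => by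
      simp [centredProduct, hab]
    simp only [hsplit]
    rcases h with ⟨h1, h2⟩ | ⟨h1, h2⟩
    · simp only [mul_assoc]
      rw [hW.integral_mul (E := {s(i, a)}) (F := {s(i, b), s(i, c), s(i, d)}) ?_ ?_ ?_,
        hW.mean _ _ ha.symm, zero_mul]
      · simp [hs, hab, h1, h2]
      · exact measurable_entry_pairSigma W (by simp)
      · refine Measurable.mul (measurable_entry_pairSigma W (by simp [Sym2.eq_swap])) ?_
        exact hmeas.mono (pairSigma_mono W (by simp)) le_rfl
    · have hcomm : ∀ ω, W ω i a * W ω b i * centredProduct W v i c d ω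
          = W ω b i * (W ω i a * centredProduct W v i c d ω) := fun ω => by ring
      simp only [hcomm]
      rw [hW.integral_mul (E := {s(i, b)}) (F := {s(i, a), s(i, c), s(i, d)}) ?_ ?_ ?_,
        hW.mean _ _ hb, zero_mul]
      · simp [hs, Ne.symm hab, h1, h2]
      · exact measurable_entry_pairSigma W (by simp [Sym2.eq_swap])
      · refine Measurable.mul (measurable_entry_pairSigma W (by simp)) ?_
        exact hmeas.mono (pairSigma_mono W (by simp)) le_rfl

/-- Orthogonality up to transposition: it leaves only two partners `f` for each `e` when the square
of the quadratic form is expanded. -/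
theorem HasIndependentPairs.integral_centredProduct_mul_eq_zero (hW : HasIndependentPairs P W)
    (hκ : ∀ a b, ∫⁻ ω, ‖W ω a b‖ₑ ^ 4 ∂P ≤ κ) (hv : ∀ a ≠ i, ∫ ω, W ω i a * W ω a i ∂P = v)
    {e f : n × n} (he : e.1 ≠ i ∧ e.2 ≠ i) (hf : f.1 ≠ i ∧ f.2 ≠ i)
    (h1 : f ≠ e) (h2 : f ≠ e.swap) :
    ∫ ω, centredProduct W v i e.1 e.2 ω * star (centredProduct W v i f.1 f.2 ω) ∂P = 0 := by
  obtain ⟨a, b⟩ := e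
  obtain ⟨c, d⟩ := f
  simp only [hW.star_centredProduct]
  simp only [ne_eq, Prod.mk.injEq, Prod.swap_prod_mk] at *
  by_cases h : (a ≠ d ∧ a ≠ c) ∨ (b ≠ d ∧ b ≠ c)
  · exact hW.integral_centredProduct_mul_of_ne hκ hv he.1 he.2 h
  -- Here `a` and `b` both occur among `c, d`, which forces `a = b`; then `c` or `d` is the
  -- unmatched index, and the two factors exchange roles.
  · simp only [mul_comm (centredProduct W v i a b _)]
    refine hW.integral_centredProduct_mul_of_ne hκ hv hf.2 hf.1 ?_
    grind

end QuadraticForm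

section QuadraticForm

variable {Ω : Type*} [MeasurableSpace Ω] {P : Measure Ω}

theorem lintegral_enorm_sq_eq {Z : Ω → ℂ} (hZ : Integrable (fun ω => Z ω * star (Z ω)) P) :
    ∫⁻ ω, ‖Z ω‖ₑ ^ 2 ∂P = ‖∫ ω, Z ω * star (Z ω) ∂P‖ₑ := by
  have h : ∀ ω, Z ω * star (Z ω) = ((‖Z ω * star (Z ω)‖ : ℝ) : ℂ) := fun ω => by
    rw [Complex.star_def, Complex.mul_conj', norm_pow, Complex.norm_real, norm_norm]
    push_cast
    rfl
  conv_rhs => rw [integral_congr_ae (Eventually.of_forall h), integral_complex_ofReal]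
  rw [← ofReal_norm, Complex.norm_real, Real.norm_of_nonneg (by positivity),
    ofReal_integral_norm_eq_lintegral_enorm hZ]
  refine lintegral_congr fun ω => ?_
  rw [enorm_mul, sq]
  simp [enorm_eq_nnnorm]

variable {n : Type*} [Fintype n] [DecidableEq n] {W : Ω → Matrix n n ℂ} {i : n} {v : ℝ} {κ : ℝ≥0}
  [IsProbabilityMeasure P]

omit [MeasurableSpace Ω] in
theorem excursion_sub_eq_sum (S : Finset n) (r : ℕ) (ω : Ω) :
    excursion S i r (W ω) - v * ∑ a ∈ S.erase i, (minor (S.erase i) (W ω) ^ r) a a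
      = ∑ e ∈ S.erase i ×ˢ S.erase i,
        centredProduct W v i e.1 e.2 ω * (minor (S.erase i) (W ω) ^ r) e.1 e.2 := by
  simp only [centredProduct, sub_mul, Finset.sum_sub_distrib, excursion]
  congr 1
  · exact Finset.sum_congr rfl fun e _ => by ring
  · rw [Finset.sum_product, Finset.mul_sum]
    refine Finset.sum_congr rfl fun a ha => ?_
    simp [ha]

omit [IsProbabilityMeasure P] [MeasurableSpace Ω] [Fintype n] in
theorem measurable_minor_erase (W : Ω → Matrix n n ℂ) (S : Finset n) (a b : n) :
    Measurable[pairSigma W {p | i ∉ p}] fun ω => minor (S.erase i) (W ω) a b := by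
  by_cases h : a ∈ S.erase i ∧ b ∈ S.erase i
  · simp only [minor, Matrix.of_apply, h, and_self, if_true]
    refine measurable_entry_pairSigma W ?_
    simp only [Finset.mem_erase] at h
    simp [Sym2.mem_iff, Ne.symm h.1.1, Ne.symm h.2.1]
  · simp only [minor, Matrix.of_apply, if_neg h, measurable_const]

/-- Concentration of the quadratic form formed from row and column `i` of a random Hermitian matrix
and the matrix with row and column `i` removed. -/
theorem HasIndependentPairs.lintegral_excursion_sub_le (hW : HasIndependentPairs P W)
    (hκ : ∀ a b, ∫⁻ ω, ‖W ω a b‖ₑ ^ 4 ∂P ≤ κ) (hv : ∀ a ≠ i, ∫ ω, W ω i a * W ω a i ∂P = v)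
    (S : Finset n) (r : ℕ) {β : ℝ≥0}
    (hβ : ∀ a ∈ S.erase i, ∫⁻ ω, ‖(minor (S.erase i) (W ω) ^ (2 * r)) a a‖ₑ ∂P ≤ β) :
    ∫⁻ ω, ‖excursion S i r (W ω) - v * ∑ a ∈ S.erase i, (minor (S.erase i) (W ω) ^ r) a a‖ₑ ^ 2 ∂P
      ≤ 128 * κ * (S.erase i).card * β := by
  set T := S.erase i with hT
  set U : n × n → Ω → ℂ := fun e => centredProduct W v i e.1 e.2
  set B : n × n → Ω → ℂ := fun e ω => (minor T (W ω) ^ r) e.1 e.2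
  have hTi : ∀ a ∈ T, a ≠ i := fun a ha => Finset.ne_of_mem_erase ha
  have hTT : ∀ e ∈ T ×ˢ T, e.1 ≠ i ∧ e.2 ≠ i := fun e he =>
    ⟨hTi _ (Finset.mem_product.mp he).1, hTi _ (Finset.mem_product.mp he).2⟩
  have hmin := hW.restrict T
  -- The squared entries of row `a` sum to at most the diagonal entry of the power `2 * r`. This
  -- gains a factor `T.card` over bounding entries one by one.
  have hBsum : ∀ a ∈ T, ∑ b ∈ T, ∫⁻ ω, ‖B (a, b) ω‖ₑ ^ 2 ∂P ≤ β := by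
    intro a ha
    rw [← lintegral_finsetSum' _ fun b _ => ((measurable_pow_apply hmin.measurable_entry r a
      b).enorm.pow_const 2).aemeasurable]
    refine (lintegral_mono fun ω => ?_).trans (hβ a ha)
    rw [← ofReal_norm, norm_pow_two_mul_apply_self (hmin.isHermitian ω),
      ENNReal.ofReal_sum_of_nonneg (fun _ _ => by positivity)]
    refine (Finset.sum_le_univ_sum_of_nonneg (fun _ => zero_le)).trans_eq ?_
    refine Finset.sum_congr rfl fun b _ => ?_
    rw [ENNReal.ofReal_pow (by positivity), ofReal_norm]
  have hBfin : ∀ e ∈ T ×ˢ T, ∫⁻ ω, ‖B e ω‖ₑ ^ 2 ∂P < ⊤ := fun e he => by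
    refine lt_of_le_of_lt ?_ (ENNReal.coe_lt_top (r := β))
    exact (Finset.single_le_sum (f := fun b => ∫⁻ ω, ‖B (e.1, b) ω‖ₑ ^ 2 ∂P)
      (fun _ _ => zero_le) (Finset.mem_product.mp he).2).trans
      (hBsum _ (Finset.mem_product.mp he).1)
  have hBswap : ∀ e, ∫⁻ ω, ‖B e.swap ω‖ₑ ^ 2 ∂P = ∫⁻ ω, ‖B e ω‖ₑ ^ 2 ∂P := fun e => by
    refine lintegral_congr fun ω => ?_
    have : B e.swap ω = star (B e ω) := (((hmin.isHermitian ω).pow r).apply _ _).symm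
    rw [this]
    simp [enorm_eq_nnnorm]
  have hUm : ∀ e, Measurable[pairSigma W {p | i ∈ p}] (U e) := fun e =>
    (measurable_centredProduct W v i e.1 e.2).mono (pairSigma_mono W (by
      rintro p (rfl | rfl) <;> simp)) le_rfl
  have hBm : ∀ e, Measurable[pairSigma W {p | i ∉ p}] (B e) := fun e =>
    measurable_pow_apply (fun a b => measurable_minor_erase W S a b) r e.1 e.2
  -- Row `i` and the minor without `i` use disjoint sets of pairs, so the expectations of the `U`
  -- and `B` factors separate.
  have hdisj : Disjoint {p : Sym2 n | i ∈ p} {p | i ∉ p} := disjoint_compl_right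
  have hUm' : ∀ e, Measurable (U e) := fun e => (hUm e).mono (hW.pairSigma_le _) le_rfl
  have hBm' : ∀ e, Measurable (B e) := fun e => (hBm e).mono (hW.pairSigma_le _) le_rfl
  have hms : Measurable (star : ℂ → ℂ) := continuous_star.measurable
  have hstar : ∀ {f : Ω → ℂ} (ω : Ω), ‖star (f ω)‖ₑ = ‖f ω‖ₑ := fun ω => by
    simp [enorm_eq_nnnorm]
  have hUU : ∀ e ∈ T ×ˢ T, ∀ f ∈ T ×ˢ T, ∫⁻ ω, ‖U e ω * star (U f ω)‖ₑ ∂P ≤ 32 * κ := by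
    intro e he f hf
    refine (lintegral_enorm_mul_le (hUm' e)).trans ?_
    simp only [hstar]
    refine (add_le_add (hW.lintegral_centredProduct_le hκ hv e.2 (hTT e he).1)
      (hW.lintegral_centredProduct_le hκ hv f.2 (hTT f hf).1)).trans_eq ?_
    ring
  have hBB : ∀ e f, ∫⁻ ω, ‖B e ω * star (B f ω)‖ₑ ∂P
      ≤ ∫⁻ ω, ‖B e ω‖ₑ ^ 2 ∂P + ∫⁻ ω, ‖B f ω‖ₑ ^ 2 ∂P := by
    intro e f
    refine (lintegral_enorm_mul_le (hBm' e)).trans_eq ?_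
    simp only [hstar]
  have hUi : ∀ e ∈ T ×ˢ T, ∀ f ∈ T ×ˢ T, Integrable (fun ω => U e ω * star (U f ω)) P :=
    fun e he f hf => ⟨((hUm' e).mul (hms.comp (hUm' f))).aestronglyMeasurable,
      (hUU e he f hf).trans_lt (ENNReal.mul_lt_top (by simp) ENNReal.coe_lt_top)⟩
  have hBi : ∀ e ∈ T ×ˢ T, ∀ f ∈ T ×ˢ T, Integrable (fun ω => B e ω * star (B f ω)) P :=
    fun e he f hf => ⟨((hBm' e).mul (hms.comp (hBm' f))).aestronglyMeasurable,
      (hBB e f).trans_lt (ENNReal.add_lt_top.mpr ⟨hBfin e he, hBfin f hf⟩)⟩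
  have hUBi : ∀ e ∈ T ×ˢ T, ∀ f ∈ T ×ˢ T,
      Integrable (fun ω => (U e ω * star (U f ω)) * (B e ω * star (B f ω))) P :=
    fun e he f hf => hW.integrable_mul hdisj ((hUm e).mul (hms.comp (hUm f)))
      ((hBm e).mul (hms.comp (hBm f))) (hUi e he f hf) (hBi e he f hf)
  have hexp : ∀ ω, (∑ e ∈ T ×ˢ T, U e ω * B e ω) * star (∑ e ∈ T ×ˢ T, U e ω * B e ω)
      = ∑ e ∈ T ×ˢ T, ∑ f ∈ T ×ˢ T, (U e ω * star (U f ω)) * (B e ω * star (B f ω)) := by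
    intro ω
    rw [star_sum, Finset.sum_mul_sum]
    refine Finset.sum_congr rfl fun e _ => Finset.sum_congr rfl fun f _ => ?_
    rw [star_mul']
    ring
  -- The factor 64 is `32 * κ` from `hUU` times 2 from `hBB`, where the `e` and `f` terms are equal.
  have hterm : ∀ e ∈ T ×ˢ T, ∀ f ∈ T ×ˢ T,
      ‖∫ ω, (U e ω * star (U f ω)) * (B e ω * star (B f ω)) ∂P‖ₑ
        ≤ (if f = e then 64 * κ * ∫⁻ ω, ‖B e ω‖ₑ ^ 2 ∂P else 0)
          + if f = e.swap then 64 * κ * ∫⁻ ω, ‖B e ω‖ₑ ^ 2 ∂P else 0 := by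
    intro e he f hf
    rw [hW.integral_mul (f := fun ω => U e ω * star (U f ω))
      (g := fun ω => B e ω * star (B f ω)) hdisj ((hUm e).mul (hms.comp (hUm f))) ((hBm e).mul (hms.comp (hBm f))), enorm_mul]
    by_cases h : f = e ∨ f = e.swap
    · have h1 : ‖∫ ω, U e ω * star (U f ω) ∂P‖ₑ * ‖∫ ω, B e ω * star (B f ω) ∂P‖ₑ
          ≤ 64 * κ * ∫⁻ ω, ‖B e ω‖ₑ ^ 2 ∂P := by
        calc _ ≤ (32 * κ) * (∫⁻ ω, ‖B e ω‖ₑ ^ 2 ∂P + ∫⁻ ω, ‖B f ω‖ₑ ^ 2 ∂P) := by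
              gcongr
              · exact (enorm_integral_le_lintegral_enorm _).trans (hUU e he f hf)
              · exact (enorm_integral_le_lintegral_enorm _).trans (hBB e f)
          _ = _ := by
              have : ∫⁻ ω, ‖B f ω‖ₑ ^ 2 ∂P = ∫⁻ ω, ‖B e ω‖ₑ ^ 2 ∂P := by
                rcases h with rfl | rfl
                · rfl
                · exact hBswap e
              rw [this]
              ring
      rcases h with h | h
      · rw [if_pos h]
        exact h1.trans le_self_add
      · rw [if_pos h]
        exact h1.trans le_add_self
    · rw [not_or] at h
      rw [show ∫ ω, U e ω * star (U f ω) ∂P = 0 from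
        hW.integral_centredProduct_mul_eq_zero hκ hv (hTT e he) (hTT f hf) h.1 h.2]
      simp
  simp only [hT, excursion_sub_eq_sum]
  change ∫⁻ ω, ‖∑ e ∈ T ×ˢ T, U e ω * B e ω‖ₑ ^ 2 ∂P ≤ _
  rw [lintegral_enorm_sq_eq]
  · simp only [hexp]
    rw [integral_finsetSum _ fun e he => integrable_finsetSum _ (hUBi e he)]
    calc _ ≤ ∑ e ∈ T ×ˢ T, ‖∫ ω, ∑ f ∈ T ×ˢ T,
            (U e ω * star (U f ω)) * (B e ω * star (B f ω)) ∂P‖ₑ := enorm_sum_le _ _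
      _ ≤ ∑ e ∈ T ×ˢ T, ∑ f ∈ T ×ˢ T, ((if f = e then 64 * κ * ∫⁻ ω, ‖B e ω‖ₑ ^ 2 ∂P else 0)
          + if f = e.swap then 64 * κ * ∫⁻ ω, ‖B e ω‖ₑ ^ 2 ∂P else 0) := by
          refine Finset.sum_le_sum fun e he => ?_
          rw [integral_finsetSum _ (hUBi e he)]
          exact (enorm_sum_le _ _).trans (Finset.sum_le_sum fun f hf => hterm e he f hf)
      _ ≤ ∑ e ∈ T ×ˢ T, 128 * κ * ∫⁻ ω, ‖B e ω‖ₑ ^ 2 ∂P := by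
          refine Finset.sum_le_sum fun e he => ?_
          have he' : e.swap ∈ T ×ˢ T := by simpa [and_comm] using he
          rw [Finset.sum_add_distrib, Finset.sum_ite_eq', Finset.sum_ite_eq', if_pos he,
            if_pos he']
          exact le_of_eq (by ring)
      _ = 128 * κ * ∑ a ∈ T, ∑ b ∈ T, ∫⁻ ω, ‖B (a, b) ω‖ₑ ^ 2 ∂P := by
          rw [← Finset.mul_sum, Finset.sum_product]
      _ ≤ 128 * κ * ∑ a ∈ T, (β : ℝ≥0∞) := by gcongr with a ha; exact hBsum a ha
      _ = _ := by rw [Finset.sum_const, nsmul_eq_mul]; ring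
  · simp only [hexp]
    exact integrable_finsetSum _ fun e he => integrable_finsetSum _ (hUBi e he)

end QuadraticForm

/-! ### Convergence over rooted minors. -/

/-- A set of indices of an `N × N` matrix together with one of its elements. -/
structure RootedMinor where
  N : ℕ
  S : Finset (Fin N)
  i : Fin N
  mem : i ∈ S

/-- The size of the ambient matrix and the proportion of the rows that belong to the minor. -/
noncomputable def RootedMinor.shape (x : RootedMinor) : ℕ × ℝ := (x.N, (x.S.card : ℝ) / x.N)

/-- The filter of large matrices and minors containing almost all of the rows. -/
noncomputable def minorFilter : Filter RootedMinor :=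
  comap RootedMinor.shape (atTop ×ˢ 𝓝 1)

section WignerSequence

variable {Ω : ℕ → Type*} [∀ N, MeasurableSpace (Ω N)] {P : ∀ N, Measure (Ω N)}
  {W : ∀ N, Ω N → Matrix (Fin N) (Fin N) ℂ} {αN : ℕ → ℝ}

/-- A sequence of random Hermitian matrices with independent entries, bounded moments, and
off-diagonal entries of mean zero and variance `αN N ^ 2`. -/
structure IsWignerSequence (P : ∀ N, Measure (Ω N)) (W : ∀ N, Ω N → Matrix (Fin N) (Fin N) ℂ)
    (αN : ℕ → ℝ) : Prop where
  pairs : ∀ N, HasIndependentPairs (P N) (W N)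
  moment : ∀ p : ℕ, ∃ C : ℝ≥0, ∀ N i j, ∫⁻ ω, ‖W N ω i j‖ₑ ^ p ∂P N ≤ C
  variance : ∀ N i j, i ≠ j → ∫ ω, W N ω i j * W N ω j i ∂P N = ((αN N ^ 2 : ℝ) : ℂ)

/-- The matrix divided by the square root of its size. -/
noncomputable def scaled (W : ∀ N, Ω N → Matrix (Fin N) (Fin N) ℂ) (N : ℕ) (ω : Ω N) :
    Matrix (Fin N) (Fin N) ℂ := (√(N : ℝ))⁻¹ • W N ω

/-- The diagonal entries of the powers of minors of the scaled matrix. -/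
noncomputable def returnEntry (W : ∀ N, Ω N → Matrix (Fin N) (Fin N) ℂ) (k : ℕ) (x : RootedMinor)
    (ω : Ω x.N) : ℂ := (minor x.S (scaled W x.N ω) ^ k) x.i x.i

theorem minor_smul {n : Type*} [DecidableEq n] (S : Finset n) (c : ℝ) (A : Matrix n n ℂ) :
    minor S (c • A) = c • minor S A := by
  ext a b
  simp [minor]

theorem RootedMinor.N_pos (x : RootedMinor) : 0 < x.N := x.i.pos

theorem nnnorm_inv_sqrt_sq_mul {N : ℕ} (hN : 0 < N) : ‖(√(N : ℝ))⁻¹‖₊ ^ 2 * (N : ℝ≥0) = 1 := by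
  have h : (N : ℝ) ≠ 0 := by positivity
  apply NNReal.coe_injective
  push_cast
  rw [norm_inv, Real.norm_of_nonneg (by positivity), inv_pow, Real.sq_sqrt (by positivity),
    inv_mul_cancel₀ h]

theorem enorm_inv_sqrt_sq_mul {N : ℕ} (hN : 0 < N) : ‖(√(N : ℝ))⁻¹‖ₑ ^ 2 * (N : ℝ≥0∞) = 1 := by
  have := congrArg ENNReal.ofNNReal (nnnorm_inv_sqrt_sq_mul hN)
  push_cast at this
  exact this

namespace IsWignerSequence

variable [∀ N, IsProbabilityMeasure (P N)]

omit [∀ N, IsProbabilityMeasure (P N)] in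
theorem scaled_pairs (hW : IsWignerSequence P W αN) (N : ℕ) :
    HasIndependentPairs (P N) (scaled W N) := (hW.pairs N).smul _

/-- The scaling contributes `N ^ (-2 ^ q * k)`, which exactly cancels the walk count, uniformly in
the minor and its root. -/
theorem boundedMoments_returnEntry (hW : IsWignerSequence P W αN) (k : ℕ) :
    BoundedMoments (fun x : RootedMinor => P x.N) (returnEntry W k) := by
  refine BoundedMoments.of_two_pow (fun x => measurable_pow_apply
    ((hW.scaled_pairs x.N).restrict x.S).measurable_entry k x.i x.i) fun q => ?_
  obtain ⟨C, hC⟩ := hW.moment (2 * (2 ^ q * k))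
  refine ⟨((2 ^ q * k + 1) ^ (2 * (2 ^ q * k) + 1) : ℕ) * (1 + (2 * (2 ^ q * k) : ℕ) * (C + 1)),
    fun x => ?_⟩
  have hres := (hW.pairs x.N).restrict x.S
  -- The extra 1 covers exponent zero, where an entry outside the minor contributes `0 ^ 0 = 1`.
  have hC' : ∀ i j, ∫⁻ ω, ‖minor x.S (W x.N ω) i j‖ₑ ^ (2 * (2 ^ q * k)) ∂P x.N ≤ C + 1 := by
    intro i j
    by_cases h : i ∈ x.S ∧ j ∈ x.S
    · simp only [minor, Matrix.of_apply, if_pos h]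
      exact (hC x.N i j).trans le_self_add
    · simp only [minor, Matrix.of_apply, if_neg h, enorm_zero, lintegral_const, measure_univ,
        mul_one]
      exact (pow_le_one₀ zero_le zero_le_one).trans le_add_self
  have hb := hres.lintegral_pow_apply_le k q (C := C + 1) (by simpa using hC') x.i
  calc ∫⁻ ω, ‖returnEntry W k x ω‖ₑ ^ 2 ^ (q + 1) ∂P x.N
      = ∫⁻ ω, (‖(√(x.N : ℝ))⁻¹‖ₑ ^ 2) ^ (2 ^ q * k)
          * ‖(minor x.S (W x.N ω) ^ k) x.i x.i‖ₑ ^ 2 ^ (q + 1) ∂P x.N := by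
        refine lintegral_congr fun ω => ?_
        rw [returnEntry, scaled, minor_smul, smul_pow, Matrix.smul_apply, enorm_smul, mul_pow,
          enorm_pow, ← pow_mul, ← pow_mul]
        congr 2
        ring
    _ = (‖(√(x.N : ℝ))⁻¹‖ₑ ^ 2) ^ (2 ^ q * k)
          * ∫⁻ ω, ‖(minor x.S (W x.N ω) ^ k) x.i x.i‖ₑ ^ 2 ^ (q + 1) ∂P x.N := by
        rw [lintegral_const_mul' _ _ (by simp)]
    _ ≤ _ := by
        refine (mul_le_mul' le_rfl hb).trans_eq ?_
        rw [Fintype.card_fin, mul_comm, mul_assoc, ← mul_pow, mul_comm (x.N : ℝ≥0∞),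
          enorm_inv_sqrt_sq_mul x.N_pos, one_pow, mul_one]

theorem tendsto_N : Tendsto RootedMinor.N minorFilter atTop :=
  tendsto_fst.comp tendsto_comap

theorem tendsto_inv_sqrt : Tendsto (fun x : RootedMinor => (√(x.N : ℝ))⁻¹) minorFilter (𝓝 0) :=
  (tendsto_inv_atTop_zero.comp (Real.tendsto_sqrt_atTop.comp tendsto_natCast_atTop_atTop)).comp
    tendsto_N

theorem nnnorm_inv_sqrt_le_one {N : ℕ} : ‖(√(N : ℝ))⁻¹‖₊ ≤ 1 := by
  rw [← NNReal.coe_le_coe]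
  rcases Nat.eq_zero_or_pos N with rfl | h
  · simp
  · push_cast
    rw [norm_inv, Real.norm_of_nonneg (by positivity)]
    exact inv_le_one_of_one_le₀ (by rw [Real.one_le_sqrt]; exact_mod_cast h)

omit [∀ N, IsProbabilityMeasure (P N)] in
theorem boundedMoments_entry (hW : IsWignerSequence P W αN) :
    BoundedMoments (fun x : RootedMinor => P x.N) fun x ω => W x.N ω x.i x.i := by
  refine ⟨fun x => (hW.pairs x.N).measurable_entry _ _, fun p => ?_⟩
  obtain ⟨C, hC⟩ := hW.moment p
  exact ⟨C, fun x => hC _ _ _⟩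

theorem tendsToZero_diagonal (hW : IsWignerSequence P W αN) :
    TendsToZero minorFilter (fun x : RootedMinor => P x.N)
      fun x ω => scaled W x.N ω x.i x.i := by
  have h := (TendsToZero.const (l := minorFilter) (P := fun x : RootedMinor => P x.N)
    (c := fun x => (((√(x.N : ℝ))⁻¹ : ℝ) : ℂ)) (C := 1) (fun x => by
      simpa [Complex.nnnorm_real] using nnnorm_inv_sqrt_le_one (N := x.N))
    (by simpa [Function.comp_def] using
      (Complex.continuous_ofReal.tendsto 0).comp tendsto_inv_sqrt)).mul
    hW.boundedMoments_entry
  convert h using 3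
  exact Complex.real_smul

omit [∀ N, MeasurableSpace (Ω N)] in
theorem returnEntry_zero (x : RootedMinor) (ω : Ω x.N) : returnEntry W 0 x ω = 1 := by
  simp [returnEntry]

omit [∀ N, MeasurableSpace (Ω N)] in
theorem returnEntry_one (x : RootedMinor) (ω : Ω x.N) :
    returnEntry W 1 x ω = scaled W x.N ω x.i x.i := by
  rw [returnEntry, minor_pow_one_apply _ x.mem]

omit [∀ N, MeasurableSpace (Ω N)] in
theorem returnEntry_add_two (k : ℕ) (x : RootedMinor) (ω : Ω x.N) :
    returnEntry W (k + 2) x ω = scaled W x.N ω x.i x.i * returnEntry W (k + 1) x ω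
      + ∑ p ∈ antidiagonal k, excursion x.S x.i p.1 (scaled W x.N ω) * returnEntry W p.2 x ω :=
  minor_pow_apply_self _ x.mem k

/-- The first-return identity can be solved for the longest excursion, whose cofactor is
`returnEntry W 0 = 1`; everything else in it is already bounded. -/
theorem boundedMoments_excursion (hW : IsWignerSequence P W αN) (k : ℕ) :
    BoundedMoments (fun x : RootedMinor => P x.N)
      fun x ω => excursion x.S x.i k (scaled W x.N ω) := by
  induction k using Nat.strong_induction_on with
  | _ k ih =>
  have hbase : BoundedMoments (fun x : RootedMinor => P x.N) fun x ω =>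
      returnEntry W (k + 2) x ω - scaled W x.N ω x.i x.i * returnEntry W (k + 1) x ω :=
    (hW.boundedMoments_returnEntry _).sub
      (hW.tendsToZero_diagonal.toBoundedMoments.mul (hW.boundedMoments_returnEntry _))
  rcases k with _ | k
  · convert hbase using 3 with x ω
    rw [returnEntry_add_two]
    simp [returnEntry_zero]
  · have hsum := BoundedMoments.finsetSum (antidiagonal k)
      (f := fun p x ω => excursion x.S x.i p.1 (scaled W x.N ω) * returnEntry W (p.2 + 1) x ω)
      fun p hp => (ih p.1 (by have := Finset.HasAntidiagonal.mem_antidiagonal.mp hp; omega)).mul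
        (hW.boundedMoments_returnEntry (p.2 + 1))
    convert hbase.sub hsum using 3 with x ω
    rw [returnEntry_add_two, Finset.Nat.sum_antidiagonal_succ']
    simp [returnEntry_zero]

omit [∀ N, IsProbabilityMeasure (P N)] in
/-- Averages of diagonal entries converge uniformly in the choice of the minor. -/
theorem lintegral_sum_returnEntry_sub_le (hW : IsWignerSequence P W αN) {r : ℕ} {m : ℂ}
    (h : TendsToConst minorFilter (fun x : RootedMinor => P x.N) (returnEntry W r) m)
    {ε : ℝ≥0∞} (hε : 0 < ε) :
    ∀ᶠ y : ℕ × ℝ in atTop ×ˢ 𝓝 1, ∀ T : Finset (Fin y.1), (T.card : ℝ) / y.1 = y.2 →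
      ∫⁻ ω, ‖∑ a ∈ T, ((minor T (scaled W y.1 ω) ^ r) a a - m)‖ₑ ^ 2 ∂P y.1
        ≤ (T.card : ℝ≥0∞) ^ 2 * ε := by
  have h1 := ENNReal.tendsto_nhds_zero.mp h.tendsto ε hε
  -- Events of `minorFilter` depend on the shape alone, so one threshold serves every minor of that
  -- shape and all its roots.
  rw [minorFilter, eventually_comap] at h1
  filter_upwards [h1] with y hy T hT
  refine lintegral_enorm_sum_sq_le (fun a _ => ?_) fun a ha => ?_
  · exact (measurable_pow_apply ((hW.scaled_pairs y.1).restrict T).measurable_entry r a a).sub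
      measurable_const
  · exact hy ⟨y.1, T, a, ha⟩ (by simp [RootedMinor.shape, hT])

/-- Deleting the root stays within almost full minors; this lets the induction hypothesis apply to
`S.erase i`. -/
theorem tendsto_shape_erase :
    Tendsto (fun x : RootedMinor => (x.N, ((x.S.erase x.i).card : ℝ) / x.N)) minorFilter
      (atTop ×ˢ 𝓝 1) := by
  refine Tendsto.prodMk tendsto_N ?_
  have h1 : Tendsto (fun x : RootedMinor => (x.S.card : ℝ) / x.N) minorFilter (𝓝 1) :=
    tendsto_snd.comp tendsto_comap
  have h2 : Tendsto (fun x : RootedMinor => (x.N : ℝ)⁻¹) minorFilter (𝓝 0) :=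
    (tendsto_inv_atTop_zero.comp tendsto_natCast_atTop_atTop).comp tendsto_N
  have h3 := h1.sub h2
  rw [sub_zero] at h3
  refine h3.congr fun x => ?_
  rw [Finset.card_erase_of_mem x.mem, Nat.cast_sub (Finset.card_pos.mpr ⟨_, x.mem⟩)]
  push_cast
  ring

omit [∀ N, IsProbabilityMeasure (P N)] in
theorem lintegral_scaled_pow (N : ℕ) (i j : Fin N) (p : ℕ) :
    ∫⁻ ω, ‖scaled W N ω i j‖ₑ ^ p ∂P N
      = ‖(√(N : ℝ))⁻¹‖ₑ ^ p * ∫⁻ ω, ‖W N ω i j‖ₑ ^ p ∂P N := by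
  simp only [scaled, Matrix.smul_apply, enorm_smul, mul_pow]
  rw [lintegral_const_mul' _ _ (by simp)]

omit [∀ N, IsProbabilityMeasure (P N)] in
theorem integral_scaled_mul (hW : IsWignerSequence P W αN) (N : ℕ) {i j : Fin N} (h : i ≠ j) :
    ∫ ω, scaled W N ω i j * scaled W N ω j i ∂P N = (((√(N : ℝ))⁻¹ ^ 2 * αN N ^ 2 : ℝ) : ℂ) := by
  have h1 : ∀ ω, scaled W N ω i j * scaled W N ω j i
      = ((√(N : ℝ))⁻¹ ^ 2 : ℝ) * (W N ω i j * W N ω j i) := fun ω => by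
    simp only [scaled, Matrix.smul_apply, Complex.real_smul]
    push_cast
    ring
  simp only [h1]
  rw [integral_const_mul, hW.variance N i j h]
  push_cast
  ring

/-- Fourth moments of scaled entries are `O(N⁻²)` and the minor has at most `N` rows, so the
variance bound is `O(1 / N)`. -/
theorem tendsto_lintegral_excursion_sub (hW : IsWignerSequence P W αN) (r : ℕ) :
    Tendsto (fun x : RootedMinor => ∫⁻ ω, ‖excursion x.S x.i r (scaled W x.N ω)
      - ((√(x.N : ℝ))⁻¹ ^ 2 * αN x.N ^ 2 : ℝ) * ∑ a ∈ x.S.erase x.i,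
        (minor (x.S.erase x.i) (scaled W x.N ω) ^ r) a a‖ₑ ^ 2 ∂P x.N) minorFilter (𝓝 0) := by
  obtain ⟨C, hC⟩ := hW.moment 4
  -- This bound is uniform over rooted minors, hence usable below for `S.erase i` rooted at any `a`.
  obtain ⟨β, hβ⟩ := (hW.boundedMoments_returnEntry (2 * r)).bound 1
  have hlim : Tendsto (fun x : RootedMinor => (128 * C * β : ℝ≥0∞) * ‖(√(x.N : ℝ))⁻¹‖ₑ ^ 2) minorFilter
      (𝓝 ((128 * C * β : ℝ≥0∞) * 0)) := by
    refine ENNReal.Tendsto.const_mul ?_ (.inr ?_)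
    · have := (ENNReal.continuous_pow 2).tendsto _ |>.comp
        ((continuous_enorm.tendsto (0 : ℝ)).comp tendsto_inv_sqrt)
      simpa [Function.comp_def] using this
    · exact ENNReal.mul_ne_top (ENNReal.mul_ne_top (by simp) ENNReal.coe_ne_top)
        ENNReal.coe_ne_top
  rw [mul_zero] at hlim
  refine tendsto_of_tendsto_of_tendsto_of_le_of_le tendsto_const_nhds hlim (fun _ => zero_le)
    fun x => ?_
  have h := (hW.scaled_pairs x.N).lintegral_excursion_sub_le (i := x.i)
    (v := (√(x.N : ℝ))⁻¹ ^ 2 * αN x.N ^ 2) (κ := ‖(√(x.N : ℝ))⁻¹‖₊ ^ 4 * C) (fun a b => by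
      rw [lintegral_scaled_pow]
      push_cast
      exact mul_le_mul' le_rfl (hC _ _ _))
    (fun a ha => hW.integral_scaled_mul x.N ha.symm) x.S r (β := β)
    (fun a ha => by
      simpa [returnEntry] using hβ ⟨x.N, x.S.erase x.i, a, ha⟩)
  refine h.trans ?_
  have hcard : ((x.S.erase x.i).card : ℝ≥0∞) ≤ x.N := by
    exact_mod_cast (Finset.card_le_univ _).trans_eq (Fintype.card_fin _)
  calc _ ≤ 128 * ((‖(√(x.N : ℝ))⁻¹‖₊ ^ 4 * C : ℝ≥0) : ℝ≥0∞) * x.N * β := by gcongr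
    _ = 128 * C * β * ‖(√(x.N : ℝ))⁻¹‖ₑ ^ 2 * (‖(√(x.N : ℝ))⁻¹‖ₑ ^ 2 * x.N) := by
        push_cast
        rw [show ‖(√(x.N : ℝ))⁻¹‖ₑ = (‖(√(x.N : ℝ))⁻¹‖₊ : ℝ≥0∞) from rfl]
        ring
    _ = _ := by rw [enorm_inv_sqrt_sq_mul x.N_pos, mul_one]

/-- Three errors are added: the fluctuation of the quadratic form, the deviation of the averaged
diagonal entries from `m`, and the deterministic difference between `αN ^ 2` times the proportion of
rows and `α ^ 2`. -/
theorem tendsToConst_excursion (hW : IsWignerSequence P W αN) {α : ℝ}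
    (hα : Tendsto αN atTop (𝓝 α)) {r : ℕ} {m : ℂ}
    (h : TendsToConst minorFilter (fun x : RootedMinor => P x.N) (returnEntry W r) m) :
    TendsToConst minorFilter (fun x : RootedMinor => P x.N)
      (fun x ω => excursion x.S x.i r (scaled W x.N ω)) ((α ^ 2 : ℝ) * m) := by
  have hαx : Tendsto (fun x : RootedMinor => αN x.N ^ 2) minorFilter (𝓝 (α ^ 2)) :=
    (hα.comp tendsto_N).pow 2
  set v : RootedMinor → ℝ := fun x => (√(x.N : ℝ))⁻¹ ^ 2 * αN x.N ^ 2 with hv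
  have hpow : ∀ (x : RootedMinor) (a : Fin x.N),
      Measurable fun ω => (minor (x.S.erase x.i) (scaled W x.N ω) ^ r) a a := fun x a =>
    measurable_pow_apply ((hW.scaled_pairs x.N).restrict _).measurable_entry r a a
  have hN : ∀ x : RootedMinor, (√(x.N : ℝ))⁻¹ ^ 2 = (x.N : ℝ)⁻¹ := fun x => by
    rw [inv_pow, Real.sq_sqrt (by positivity)]
  have h2 : Tendsto (fun x : RootedMinor => ∫⁻ ω, ‖(v x : ℂ) * ∑ a ∈ x.S.erase x.i,
      ((minor (x.S.erase x.i) (scaled W x.N ω) ^ r) a a - m)‖ₑ ^ 2 ∂P x.N) minorFilter (𝓝 0) := by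
    have hg : Tendsto (fun x : RootedMinor => ‖(x.N : ℝ)⁻¹‖ₑ ^ 2 * ∫⁻ ω, ‖∑ a ∈ x.S.erase x.i,
        ((minor (x.S.erase x.i) (scaled W x.N ω) ^ r) a a - m)‖ₑ ^ 2 ∂P x.N)
        minorFilter (𝓝 0) := by
      rw [ENNReal.tendsto_nhds_zero]
      intro ε hε
      filter_upwards [tendsto_shape_erase.eventually (hW.lintegral_sum_returnEntry_sub_le h hε)]
        with x hx
      have hcard : ((x.S.erase x.i).card : ℝ≥0∞) ≤ x.N := by
        exact_mod_cast (Finset.card_le_univ _).trans_eq (Fintype.card_fin _)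
      have h1 : ‖(x.N : ℝ)⁻¹‖ₑ * x.N = 1 := by
        rw [← hN, enorm_pow, enorm_inv_sqrt_sq_mul x.N_pos]
      calc _ ≤ ‖(x.N : ℝ)⁻¹‖ₑ ^ 2 * ((x.S.erase x.i).card ^ 2 * ε) :=
            mul_le_mul' le_rfl (hx _ rfl)
        _ ≤ ‖(x.N : ℝ)⁻¹‖ₑ ^ 2 * (x.N ^ 2 * ε) := by gcongr
        _ = ε := by rw [← mul_assoc, ← mul_pow, h1, one_pow, one_mul]
    have hb : Tendsto (fun x : RootedMinor => ‖αN x.N ^ 2‖ₑ ^ 2) minorFilter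
        (𝓝 (‖α ^ 2‖ₑ ^ 2)) :=
      (ENNReal.continuous_pow 2).tendsto _ |>.comp ((continuous_enorm.tendsto _).comp hαx)
    have := ENNReal.Tendsto.mul hb (.inr (by simp)) hg (.inr (by simp))
    rw [mul_zero] at this
    refine this.congr fun x => ?_
    rw [← mul_assoc, ← lintegral_const_mul' _ _ (by finiteness)]
    refine lintegral_congr fun ω => ?_
    rw [enorm_mul, mul_pow, hv]
    simp only [hN]
    rw [show ‖(((x.N : ℝ)⁻¹ * αN x.N ^ 2 : ℝ) : ℂ)‖ₑ = ‖(x.N : ℝ)⁻¹‖ₑ * ‖αN x.N ^ 2‖ₑ by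
      rw [← enorm_mul, ← ofReal_norm, Complex.norm_real, ofReal_norm]]
    ring
  have h3 : Tendsto (fun x : RootedMinor => ∫⁻ _ : Ω x.N,
      ‖(v x : ℂ) * ((x.S.erase x.i).card * m) - (α ^ 2 : ℝ) * m‖ₑ ^ 2 ∂P x.N)
      minorFilter (𝓝 0) := by
    simp only [lintegral_const, measure_univ, mul_one]
    have hc : Tendsto (fun x : RootedMinor =>
        (v x : ℂ) * ((x.S.erase x.i).card * m) - (α ^ 2 : ℝ) * m) minorFilter (𝓝 0) := by
      have h1 : Tendsto (fun x : RootedMinor => αN x.N ^ 2 * (((x.S.erase x.i).card : ℝ) / x.N))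
          minorFilter (𝓝 (α ^ 2 * 1)) := hαx.mul (tendsto_snd.comp tendsto_shape_erase)
      have h2 := (((Complex.continuous_ofReal.tendsto _).comp h1).mul_const m).sub_const
        ((α ^ 2 : ℝ) * m)
      rw [mul_one, sub_self] at h2
      refine h2.congr fun x => ?_
      simp only [hv, hN, Function.comp_apply]
      push_cast
      ring
    have := (ENNReal.continuous_pow 2).tendsto _ |>.comp
      ((continuous_enorm.tendsto _).comp hc)
    simpa [Function.comp_def] using this
  refine ⟨(hW.boundedMoments_excursion r).sub (BoundedMoments.const
    (c := fun _ => (α ^ 2 : ℝ) * m) fun _ => le_rfl), ?_⟩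
  have h23 := tendsto_lintegral_add_sq (fun x => (Finset.measurable_sum _ fun a _ =>
    (hpow x a).sub measurable_const).const_mul _) h2 h3
  have h123 := tendsto_lintegral_add_sq (fun x =>
    ((hW.boundedMoments_excursion r).measurable x).sub ((Finset.measurable_sum _ fun a _ =>
      hpow x a).const_mul _)) (hW.tendsto_lintegral_excursion_sub r) h23
  refine h123.congr fun x => lintegral_congr fun ω => ?_
  congr 2
  simp only [Pi.sub_apply, Finset.sum_sub_distrib, Finset.sum_const, nsmul_eq_mul, hv]
  ring

/-- The diagonal entries of the powers of the scaled matrix converge to the solution of the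
recursion of first returns. -/
theorem tendsToConst_returnEntry (hW : IsWignerSequence P W αN) {α : ℝ}
    (hα : Tendsto αN atTop (𝓝 α)) {m : ℕ → ℝ} (h0 : m 0 = 1) (h1 : m 1 = 0)
    (h2 : ∀ k, m (k + 2) = ∑ p ∈ antidiagonal k, α ^ 2 * m p.1 * m p.2) (k : ℕ) :
    TendsToConst minorFilter (fun x : RootedMinor => P x.N) (returnEntry W k) (m k) := by
  induction k using Nat.strong_induction_on with
  | _ k ih =>
  match k with
  | 0 =>
    convert TendsToConst.const (l := minorFilter) (P := fun x : RootedMinor => P x.N) 1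
      using 1
    · funext x ω
      exact returnEntry_zero x ω
    · simp [h0]
  | 1 =>
    simpa [TendsToConst, h1, returnEntry_one] using hW.tendsToZero_diagonal
  | k + 2 =>
    have hd : TendsToConst minorFilter (fun x : RootedMinor => P x.N)
        (fun x ω => scaled W x.N ω x.i x.i * returnEntry W (k + 1) x ω) 0 := by
      simpa [TendsToConst] using
        hW.tendsToZero_diagonal.mul (hW.boundedMoments_returnEntry (k + 1))
    have hs := TendsToConst.finsetSum (l := minorFilter) (P := fun x : RootedMinor => P x.N)
      (antidiagonal k)
      (f := fun p x ω => excursion x.S x.i p.1 (scaled W x.N ω) * returnEntry W p.2 x ω)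
      (c := fun p => (α ^ 2 : ℝ) * m p.1 * m p.2) fun p hp => by
        have := Finset.HasAntidiagonal.mem_antidiagonal.mp hp
        exact (hW.tendsToConst_excursion hα (ih p.1 (by omega))).mul (ih p.2 (by omega))
    convert hd.add hs using 1
    · funext x ω
      exact returnEntry_add_two k x ω
    · rw [h2]
      push_cast
      ring

theorem integrable_scaled_pow_apply (hW : IsWignerSequence P W αN) (N k : ℕ) (i j : Fin N) :
    Integrable (fun ω => (scaled W N ω ^ k) i j) (P N) := by
  obtain ⟨C, hC⟩ := hW.moment k
  simp only [scaled, smul_pow, Matrix.smul_apply]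
  exact Integrable.smul ((√(N : ℝ))⁻¹ ^ k) ((hW.pairs N).integrable_pow_apply (hC N) i j)

theorem tendsto_integral_trace (hW : IsWignerSequence P W αN) {α : ℝ}
    (hα : Tendsto αN atTop (𝓝 α)) {m : ℕ → ℝ} (h0 : m 0 = 1) (h1 : m 1 = 0)
    (h2 : ∀ k, m (k + 2) = ∑ p ∈ antidiagonal k, α ^ 2 * m p.1 * m p.2) (k : ℕ) :
    Tendsto (fun N => ∫ ω, (N : ℂ)⁻¹ * (scaled W N ω ^ k).trace ∂P N) atTop (𝓝 (m k)) := by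
  have hsq : Tendsto (fun N => ‖(∫ ω, (N : ℂ)⁻¹ * (scaled W N ω ^ k).trace ∂P N) - m k‖ₑ ^ 2)
      atTop (𝓝 0) := by
    rw [ENNReal.tendsto_nhds_zero]
    intro ε hε
    -- The full matrix is the minor of proportion exactly 1.
    have hshape : Tendsto (fun N : ℕ => (N, (1 : ℝ))) atTop (atTop ×ˢ 𝓝 1) :=
      tendsto_id.prodMk tendsto_const_nhds
    filter_upwards [hshape.eventually (hW.lintegral_sum_returnEntry_sub_le
      (hW.tendsToConst_returnEntry hα h0 h1 h2 k) hε), eventually_gt_atTop 0] with N hN hpos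
    have hNC : (N : ℂ) ≠ 0 := by exact_mod_cast hpos.ne'
    have hNR : (N : ℝ) ≠ 0 := by exact_mod_cast hpos.ne'
    have huniv : ∀ A : Matrix (Fin N) (Fin N) ℂ, minor Finset.univ A = A := fun A => by
      ext a b
      simp [minor]
    have hN' := hN Finset.univ (by simp [hNR])
    simp only [huniv, Finset.card_univ, Fintype.card_fin] at hN'
    have hint : Integrable (fun ω => (N : ℂ)⁻¹ * (scaled W N ω ^ k).trace) (P N) :=
      (integrable_finsetSum _ fun i _ => hW.integrable_scaled_pow_apply N k i i).const_mul _
    have heq : (∫ ω, (N : ℂ)⁻¹ * (scaled W N ω ^ k).trace ∂P N) - m k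
        = ∫ ω, (N : ℂ)⁻¹ * ∑ a, ((scaled W N ω ^ k) a a - m k) ∂P N := by
      have : ∀ ω, (N : ℂ)⁻¹ * ∑ a, ((scaled W N ω ^ k) a a - m k)
          = (N : ℂ)⁻¹ * (scaled W N ω ^ k).trace - m k := fun ω => by
        simp only [Finset.sum_sub_distrib, Finset.sum_const, Finset.card_univ, Fintype.card_fin,
          nsmul_eq_mul, Matrix.trace, Matrix.diag_apply]
        field_simp
      simp only [this]
      rw [integral_sub hint (integrable_const _)]
      simp
    have hinv : ‖(N : ℂ)⁻¹‖ₑ * N = 1 := by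
      rw [enorm_inv hNC, show ‖(N : ℂ)‖ₑ = N by simp [enorm_eq_nnnorm]]
      exact ENNReal.inv_mul_cancel (by exact_mod_cast hpos.ne') (by simp)
    rw [heq]
    calc _ ≤ ∫⁻ ω, ‖(N : ℂ)⁻¹ * ∑ a, ((scaled W N ω ^ k) a a - m k)‖ₑ ^ 2 ∂P N := by
          refine enorm_integral_sq_le (Integrable.aestronglyMeasurable ?_)
          exact (integrable_finsetSum _ fun i _ => (hW.integrable_scaled_pow_apply N k i i).sub
            (integrable_const _)).const_mul _
      _ = ‖(N : ℂ)⁻¹‖ₑ ^ 2 * ∫⁻ ω, ‖∑ a, ((scaled W N ω ^ k) a a - m k)‖ₑ ^ 2 ∂P N := by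
          simp only [enorm_mul, mul_pow]
          rw [lintegral_const_mul' _ _ (by finiteness)]
      _ ≤ ‖(N : ℂ)⁻¹‖ₑ ^ 2 * (N ^ 2 * ε) := by gcongr
      _ = ε := by rw [← mul_assoc, ← mul_pow, hinv, one_pow, one_mul]
  have hnorm : Tendsto (fun N =>
      ‖(∫ ω, (N : ℂ)⁻¹ * (scaled W N ω ^ k).trace ∂P N) - m k‖) atTop (𝓝 0) := by
    have h3 := (ENNReal.tendsto_toReal ENNReal.zero_ne_top).comp hsq
    have h4 := (Real.continuous_sqrt.tendsto _).comp h3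
    simpa [Function.comp_def] using h4
  exact tendsto_iff_norm_sub_tendsto_zero.mpr hnorm

end IsWignerSequence

end WignerSequence

/-! ### Moments of the semicircle law and Catalan numbers. -/

theorem integral_sin_even_pow_centralBinom (j : ℕ) :
    ∫ x in (-(Real.pi / 2))..(Real.pi / 2), Real.sin x ^ (2 * j)
      = Real.pi * j.centralBinom / 4 ^ j := by
  induction j with
  | zero => simp
  | succ j ih =>
    rw [show 2 * (j + 1) = 2 * j + 2 by ring, integral_sin_pow, ih]
    have h : ((j : ℝ) + 1) * (j + 1).centralBinom = 2 * (2 * j + 1) * j.centralBinom := by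
      exact_mod_cast Nat.succ_mul_centralBinom_succ j
    have h' : ((j + 1).centralBinom : ℝ) = 2 * (2 * j + 1) * j.centralBinom / (j + 1) := by
      field_simp
      linarith
    rw [h', Real.cos_neg, Real.cos_pi_div_two]
    push_cast
    field_simp
    ring

theorem integral_sin_even_pow_mul_cos_sq (j : ℕ) :
    ∫ x in (-(Real.pi / 2))..(Real.pi / 2), Real.sin x ^ (2 * j) * Real.cos x ^ 2
      = Real.pi * catalan j / (2 * 4 ^ j) := by
  have h1 : ∀ x : ℝ, Real.sin x ^ (2 * j) * Real.cos x ^ 2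
      = Real.sin x ^ (2 * j) - Real.sin x ^ (2 * j + 2) := fun x => by
    rw [Real.cos_sq']
    ring
  simp only [h1]
  rw [intervalIntegral.integral_sub (by apply Continuous.intervalIntegrable; fun_prop)
    (by apply Continuous.intervalIntegrable; fun_prop), integral_sin_pow,
    integral_sin_even_pow_centralBinom]
  have h : ((j : ℝ) + 1) * catalan j = j.centralBinom := by
    exact_mod_cast succ_mul_catalan_eq_centralBinom j
  rw [← h, Real.cos_neg, Real.cos_pi_div_two]
  push_cast
  field_simp
  ring

/-- The substitution `x = 2 * α * sin θ` turns the square root into `2 * α * cos θ`, as the cosine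
is nonnegative on the range. -/
theorem semicircleMoment_two_mul {α : ℝ} (hα : 0 < α) (j : ℕ) :
    semicircleMoment α (2 * j) = α ^ (2 * j) * catalan j := by
  have hsub : ∫ x in (-2 * α)..(2 * α), x ^ (2 * j) * √(4 * α ^ 2 - x ^ 2)
      = ∫ θ in (-(Real.pi / 2))..(Real.pi / 2),
        ((2 * α * Real.sin θ) ^ (2 * j) * √(4 * α ^ 2 - (2 * α * Real.sin θ) ^ 2))
          * (2 * α * Real.cos θ) := by
    have := intervalIntegral.integral_comp_mul_deriv (a := -(Real.pi / 2)) (b := Real.pi / 2)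
      (f := fun θ => 2 * α * Real.sin θ) (f' := fun θ => 2 * α * Real.cos θ)
      (g := fun x => x ^ (2 * j) * √(4 * α ^ 2 - x ^ 2))
      (fun θ _ => (Real.hasDerivAt_sin θ).const_mul _) (by fun_prop) (by fun_prop)
    simp only [Function.comp_def, Real.sin_neg, Real.sin_pi_div_two] at this
    rw [this]
    congr 1 <;> ring
  have hcongr : ∫ θ in (-(Real.pi / 2))..(Real.pi / 2),
        ((2 * α * Real.sin θ) ^ (2 * j) * √(4 * α ^ 2 - (2 * α * Real.sin θ) ^ 2))
          * (2 * α * Real.cos θ)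
      = ∫ θ in (-(Real.pi / 2))..(Real.pi / 2),
        (2 * α) ^ (2 * j + 2) * (Real.sin θ ^ (2 * j) * Real.cos θ ^ 2) := by
    refine intervalIntegral.integral_congr fun θ hθ => ?_
    rw [Set.uIcc_of_le (by linarith [Real.pi_pos])] at hθ
    have hcos : 0 ≤ Real.cos θ := Real.cos_nonneg_of_mem_Icc hθ
    have hs : 4 * α ^ 2 - (2 * α * Real.sin θ) ^ 2 = (2 * α * Real.cos θ) ^ 2 := by
      nlinarith [Real.sin_sq_add_cos_sq θ]
    simp only [hs]
    rw [Real.sqrt_sq (by positivity)]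
    ring
  rw [semicircleMoment, if_pos (even_two_mul j), hsub, hcongr,
    intervalIntegral.integral_const_mul, integral_sin_even_pow_mul_cos_sq]
  have h4 : (2 : ℝ) ^ (2 * j) = 4 ^ j := by rw [pow_mul]; norm_num
  rw [mul_pow, pow_add, h4]
  have := Real.pi_ne_zero
  field_simp
  ring

theorem semicircleMoment_odd (α : ℝ) {k : ℕ} (hk : Odd k) : semicircleMoment α k = 0 := by
  rw [semicircleMoment, if_neg (Nat.not_even_iff_odd.mpr hk)]

theorem semicircleMoment_zero {α : ℝ} (hα : 0 < α) : semicircleMoment α 0 = 1 := by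
  simpa using semicircleMoment_two_mul hα 0

/-- The Catalan recursion for the moments of the semicircle law. -/
theorem semicircleMoment_add_two {α : ℝ} (hα : 0 < α) (k : ℕ) :
    semicircleMoment α (k + 2) = ∑ p ∈ antidiagonal k,
      α ^ 2 * semicircleMoment α p.1 * semicircleMoment α p.2 := by
  rcases Nat.even_or_odd' k with ⟨j, rfl | rfl⟩
  · rw [show 2 * j + 2 = 2 * (j + 1) by ring, semicircleMoment_two_mul hα, catalan_succ']
    push_cast
    rw [Finset.mul_sum]
    -- Doubling indices matches the Catalan sum with the even-even terms; the remaining terms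
    -- contain odd moments and vanish.
    refine Finset.sum_of_injOn (fun p => (2 * p.1, 2 * p.2)) ?_ ?_ ?_ ?_
    · intro p _ q _ h
      simp only [Prod.mk.injEq] at h
      ext <;> omega
    · intro p hp
      simp only [Finset.mem_coe, Finset.HasAntidiagonal.mem_antidiagonal] at hp ⊢
      omega
    · rintro ⟨a, b⟩ hp hnot
      simp only [Finset.HasAntidiagonal.mem_antidiagonal] at hp
      rcases Nat.even_or_odd' a with ⟨c, rfl | rfl⟩
      · refine absurd ⟨(c, j - c), ?_, ?_⟩ hnot
        · simp only [Finset.mem_coe, Finset.HasAntidiagonal.mem_antidiagonal]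
          omega
        · simp only [Prod.mk.injEq, true_and]
          omega
      · simp [semicircleMoment_odd α (k := 2 * c + 1) ⟨c, rfl⟩]
    · rintro ⟨a, b⟩ hp
      simp only [Finset.HasAntidiagonal.mem_antidiagonal] at hp
      simp only [semicircleMoment_two_mul hα]
      rw [← hp]
      ring
  · rw [semicircleMoment_odd α ⟨j + 1, by ring⟩]
    symm
    refine Finset.sum_eq_zero fun p hp => ?_
    have hp' := Finset.HasAntidiagonal.mem_antidiagonal.mp hp
    rcases Nat.even_or_odd p.1 with h | h
    · have : Odd p.2 := by
        rw [← Nat.not_even_iff_odd]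
        intro h2
        have := h.add h2
        rw [hp'] at this
        exact (Nat.not_even_iff_odd.mpr ⟨j, rfl⟩) this
      rw [semicircleMoment_odd α this, mul_zero]
    · rw [semicircleMoment_odd α h, mul_zero, zero_mul]

/-! ### Spectral measures, traces and measurability. -/

theorem sum_eigenvalue_pow {N : ℕ} (A : HermitianMatrix N) (k : ℕ) :
    ((∑ i, eigenvalue A i ^ k : ℝ) : ℂ) = ((A : Matrix (Fin N) (Fin N) ℂ) ^ k).trace := by
  have hA := Matrix.isHermitian_iff_isSelfAdjoint.mpr A.2
  conv_rhs => rw [hA.spectral_theorem]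
  rw [← map_pow, Unitary.conjStarAlgAut_apply, Matrix.trace_mul_comm, ← mul_assoc,
    Unitary.coe_star_mul_self, one_mul, Matrix.diagonal_pow, Matrix.trace_diagonal]
  push_cast
  rfl

theorem sum_eigenvalue_pow_eq_re {N : ℕ} (A : HermitianMatrix N) (k : ℕ) :
    ∑ i, eigenvalue A i ^ k = ((A : Matrix (Fin N) (Fin N) ℂ) ^ k).trace.re := by
  rw [← sum_eigenvalue_pow, Complex.ofReal_re]

/-- The indicator function of a half-line is a pointwise limit of polynomials on the whole line. -/
theorem exists_polynomial_tendsto_indicator_Iic (t : ℝ) : ∃ p : ℕ → Polynomial ℝ, ∀ x,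
    Tendsto (fun n => (p n).eval x) atTop (𝓝 ((Set.Iic t).indicator 1 x)) := by
  -- A ramp from 1 at `t` to 0 at `t + 1 / n`. Approximating it on `[-n, n]` alone suffices, since
  -- each `x` eventually lies there.
  let f : ℕ → ℝ → ℝ := fun n x => max 0 (1 - n * max (x - t) 0)
  have hf : ∀ n, Continuous (f n) := fun n => by fun_prop
  have hex : ∀ n : ℕ, ∃ p : Polynomial ℝ, ∀ x ∈ Set.Icc (-(n : ℝ)) n,
      |p.eval x - f n x| < 1 / ((n : ℝ) + 1) := fun n =>
    exists_polynomial_near_of_continuousOn _ _ _ (hf n).continuousOn _ (by positivity)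
  choose p hp using hex
  refine ⟨p, fun x => ?_⟩
  have h1 : Tendsto (fun n => f n x) atTop (𝓝 ((Set.Iic t).indicator 1 x)) := by
    rcases le_or_gt x t with hx | hx
    · simp [f, Set.indicator_of_mem (Set.mem_Iic.mpr hx), max_eq_right (sub_nonpos.mpr hx)]
    · rw [Set.indicator_of_notMem (by simpa using hx)]
      refine tendsto_const_nhds.congr' ?_
      obtain ⟨n₀, hn₀⟩ := exists_nat_gt (1 / (x - t))
      filter_upwards [eventually_ge_atTop n₀] with n hn
      have hpos : 0 < x - t := sub_pos.mpr hx
      have hn' : (n₀ : ℝ) ≤ n := by exact_mod_cast hn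
      have : 1 < n * (x - t) := by
        rw [div_lt_iff₀ hpos] at hn₀
        nlinarith
      simp only [f]
      rw [max_eq_left hpos.le, max_eq_left (by linarith)]
  have h2 : Tendsto (fun n => (p n).eval x - f n x) atTop (𝓝 0) := by
    rw [tendsto_zero_iff_abs_tendsto_zero]
    refine squeeze_zero' (Eventually.of_forall fun n => abs_nonneg _) ?_
      tendsto_one_div_add_atTop_nhds_zero_nat
    obtain ⟨n₀, hn₀⟩ := exists_nat_gt |x|
    filter_upwards [eventually_ge_atTop n₀] with n hn
    have hn' : (n₀ : ℝ) ≤ n := by exact_mod_cast hn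
    exact (hp n x (abs_le.mp (hn₀.le.trans hn'))).le
  simpa using h2.add h1

section Measurability

variable {Ω : Type*} [MeasurableSpace Ω] {N : ℕ} {A : Ω → HermitianMatrix N}

theorem measurable_sum_eigenvalue_pow (hA : ∀ i j, Measurable fun ω => entry (A ω) i j) (k : ℕ) :
    Measurable fun ω => ∑ i, eigenvalue (A ω) i ^ k := by
  simp only [sum_eigenvalue_pow_eq_re, Matrix.trace, Matrix.diag_apply]
  exact Complex.measurable_re.comp (Finset.measurable_sum _ fun i _ =>
    measurable_pow_apply (W := fun ω => (A ω : Matrix (Fin N) (Fin N) ℂ)) hA k i i)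

/-- Power sums of eigenvalues are traces, so polynomial sums and their pointwise limits are
measurable; no measurable choice of single eigenvalues is needed. -/
theorem measurable_sum_indicator_eigenvalue (hA : ∀ i j, Measurable fun ω => entry (A ω) i j)
    (t : ℝ) : Measurable fun ω => ∑ i, (Set.Iic t).indicator (1 : ℝ → ℝ) (eigenvalue (A ω) i) := by
  obtain ⟨p, hp⟩ := exists_polynomial_tendsto_indicator_Iic t
  refine measurable_of_tendsto_metrizable (f := fun n ω => ∑ i, (p n).eval (eigenvalue (A ω) i))
    (fun n => ?_) (tendsto_pi_nhds.mpr fun ω => tendsto_finsetSum _ fun i _ => hp _)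
  simp only [Polynomial.eval_eq_sum_range]
  simp_rw [Finset.sum_comm (s := Finset.univ), ← Finset.mul_sum]
  exact Finset.measurable_sum _ fun k _ => (measurable_sum_eigenvalue_pow hA k).const_mul _

instance isProbabilityMeasure_empiricalSpectralMeasure [NeZero N] (B : HermitianMatrix N) :
    IsProbabilityMeasure (empiricalSpectralMeasure B) := by
  constructor
  simp only [empiricalSpectralMeasure, Measure.smul_apply, Measure.finsetSum_apply, measure_univ,
    Finset.sum_const, Finset.card_univ, Fintype.card_fin, smul_eq_mul, nsmul_eq_mul, mul_one]
  exact ENNReal.inv_mul_cancel (by exact_mod_cast NeZero.ne N) (by simp)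

theorem measurable_empiricalSpectralMeasure [NeZero N]
    (hA : ∀ i j, Measurable fun ω => entry (A ω) i j) :
    Measurable fun ω => empiricalSpectralMeasure (A ω) := by
  refine Measurable.measure_of_isPiSystem_of_isProbabilityMeasure (borel_eq_generateFrom_Iic ℝ)
    isPiSystem_Iic ?_
  rintro s ⟨t, rfl⟩
  have h : ∀ ω, empiricalSpectralMeasure (A ω) (Set.Iic t) = (N : ℝ≥0∞)⁻¹
      * ENNReal.ofReal (∑ i, (Set.Iic t).indicator (1 : ℝ → ℝ) (eigenvalue (A ω) i)) := fun ω => by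
    rw [ENNReal.ofReal_sum_of_nonneg fun i _ => Set.indicator_nonneg (by simp) _]
    simp only [empiricalSpectralMeasure, Measure.smul_apply, Measure.finsetSum_apply, smul_eq_mul,
      Measure.dirac_apply' _ measurableSet_Iic]
    congr 1
    refine Finset.sum_congr rfl fun i _ => ?_
    by_cases hi : eigenvalue (A ω) i ∈ Set.Iic t <;> simp [Set.indicator, hi]
  simp only [h]
  exact (measurable_sum_indicator_eigenvalue hA t).ennreal_ofReal.const_mul _

theorem integral_empiricalSpectralMeasure (B : HermitianMatrix N) (f : ℝ → ℝ) :
    ∫ x, f x ∂empiricalSpectralMeasure B = (N : ℝ)⁻¹ * ∑ i, f (eigenvalue B i) := by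
  rw [empiricalSpectralMeasure, integral_smul_measure,
    integral_finsetSum_measure fun i _ => integrable_dirac (by simp)]
  simp [integral_dirac]

theorem integrable_empiricalSpectralMeasure [NeZero N] (B : HermitianMatrix N)
    (f : ℝ → ℝ) : Integrable f (empiricalSpectralMeasure B) := by
  refine Integrable.smul_measure ?_ (by simp [NeZero.ne N])
  exact integrable_finsetSum_measure.mpr fun i _ => integrable_dirac (by simp)

/-- The averaged spectral moments as moments of the eigenvalue density. -/
theorem integrable_and_integral_bind_empiricalSpectralMeasure [NeZero N] {P : Measure Ω}
    [IsProbabilityMeasure P] (hA : ∀ i j, Measurable fun ω => entry (A ω) i j)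
    (hint : ∀ k, Integrable (fun ω => ((A ω : Matrix (Fin N) (Fin N) ℂ) ^ k).trace) P) (k : ℕ) :
    Integrable (fun x : ℝ => x ^ k) (P.bind fun ω => empiricalSpectralMeasure (A ω)) ∧
      ((∫ x, x ^ k ∂(P.bind fun ω => empiricalSpectralMeasure (A ω)) : ℝ) : ℂ)
        = ∫ ω, (N : ℂ)⁻¹ * ((A ω : Matrix (Fin N) (Fin N) ℂ) ^ k).trace ∂P := by
  let κ : Kernel Ω ℝ := ⟨fun ω => empiricalSpectralMeasure (A ω),
    measurable_empiricalSpectralMeasure hA⟩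
  have hκ : ∀ ω, κ ω = empiricalSpectralMeasure (A ω) := fun _ => rfl
  have : IsMarkovKernel κ := ⟨fun ω => by rw [hκ]; infer_instance⟩
  change Integrable (fun x : ℝ => x ^ k) (κ ∘ₘ P) ∧ ((∫ x, x ^ k ∂(κ ∘ₘ P) : ℝ) : ℂ) = _
  have hI : Integrable (fun x : ℝ => x ^ k) (κ ∘ₘ P) := by
    rw [Measure.integrable_comp_iff (continuous_pow k).aestronglyMeasurable]
    refine ⟨Eventually.of_forall fun ω => integrable_empiricalSpectralMeasure _ _, ?_⟩
    -- Absolute moments are not traces, but `|x| ^ k ≤ 1 + x ^ (2 * k)` dominates them by one.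
    have hdom : Integrable (fun ω => 1 + (N : ℝ)⁻¹ * ∑ i, eigenvalue (A ω) i ^ (2 * k)) P := by
      simp only [sum_eigenvalue_pow_eq_re]
      exact (integrable_const _).add ((hint (2 * k)).re.const_mul _)
    refine hdom.mono' ?_ (Eventually.of_forall fun ω => ?_)
    · exact (StronglyMeasurable.integral_kernel
        (continuous_pow k).norm.stronglyMeasurable).aestronglyMeasurable
    · rw [Real.norm_of_nonneg (by positivity), hκ, integral_empiricalSpectralMeasure]
      have hN : (N : ℝ) ≠ 0 := by exact_mod_cast NeZero.ne N
      calc (N : ℝ)⁻¹ * ∑ i, ‖eigenvalue (A ω) i ^ k‖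
          ≤ (N : ℝ)⁻¹ * ∑ i, (1 + eigenvalue (A ω) i ^ (2 * k)) := by
            gcongr with i
            rw [Real.norm_eq_abs, mul_comm 2 k, pow_mul, ← sq_abs]
            nlinarith [sq_nonneg (|eigenvalue (A ω) i ^ k| - 1)]
        _ = _ := by
            rw [Finset.sum_add_distrib]
            simp
            field_simp
  refine ⟨hI, ?_⟩
  have hcomp : ∫ x, x ^ k ∂(κ ∘ₘ P) = ∫ ω, ∫ x, x ^ k ∂(κ ω) ∂P := by
    rw [Measure.comp_eq_comp_const_apply] at hI ⊢
    rw [Kernel.integral_comp hI, Kernel.const_apply]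
  rw [hcomp, ← integral_complex_ofReal]
  refine integral_congr_ae (Eventually.of_forall fun ω => ?_)
  simp only [hκ, integral_empiricalSpectralMeasure]
  rw [← sum_eigenvalue_pow]
  push_cast
  rfl

end Measurability

/-! ### From independent real coordinates to independent entries. -/

/-- The unordered pair of indices of a matrix entry that a real coordinate belongs to. -/
def coordinatePair {N : ℕ} : Fin N ⊕ (UpperIndex N ⊕ UpperIndex N) → Sym2 (Fin N)
  | Sum.inl i => s(i, i)
  | Sum.inr (Sum.inl p) => s(p.1.1, p.1.2)
  | Sum.inr (Sum.inr p) => s(p.1.1, p.1.2)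

theorem entry_conj {N : ℕ} (A : HermitianMatrix N) (i j : Fin N) :
    star (entry A j i) = entry A i j :=
  (Matrix.isHermitian_iff_isSelfAdjoint.mpr A.2).apply i j

section Coordinates

variable {Ω : Type*} {N : ℕ} {M : Ω → HermitianMatrix N} {m : MeasurableSpace Ω}

theorem measurable_entry_of_lt {i j : Fin N} (h : i < j)
    (hre : Measurable[m] fun ω => realCoordinate (M ω) (Sum.inr (Sum.inl ⟨(i, j), h⟩)))
    (him : Measurable[m] fun ω => realCoordinate (M ω) (Sum.inr (Sum.inr ⟨(i, j), h⟩))) :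
    Measurable[m] fun ω => entry (M ω) i j := by
  have : (fun ω => entry (M ω) i j) = fun ω =>
      ((realCoordinate (M ω) (Sum.inr (Sum.inl ⟨(i, j), h⟩)) : ℝ) : ℂ)
        + (realCoordinate (M ω) (Sum.inr (Sum.inr ⟨(i, j), h⟩)) : ℝ) * Complex.I := by
    funext ω
    exact (Complex.re_add_im _).symm
  rw [this]
  exact (Complex.measurable_ofReal.comp hre).add
    ((Complex.measurable_ofReal.comp him).mul measurable_const)

theorem measurable_entry_of_coordinates {i j : Fin N}
    (h : ∀ c, coordinatePair c = s(i, j) → Measurable[m] fun ω => realCoordinate (M ω) c) :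
    Measurable[m] fun ω => entry (M ω) i j := by
  rcases lt_trichotomy i j with hij | rfl | hij
  · exact measurable_entry_of_lt hij (h _ rfl) (h _ rfl)
  · have : (fun ω => entry (M ω) i i) = fun ω =>
        ((realCoordinate (M ω) (Sum.inl i) : ℝ) : ℂ) := by
      funext ω
      exact (Complex.conj_eq_iff_re.mp (entry_conj (M ω) i i)).symm
    rw [this]
    exact Complex.measurable_ofReal.comp (h _ rfl)
  · have : (fun ω => entry (M ω) i j) = fun ω => star (entry (M ω) j i) :=
      funext fun ω => (entry_conj (M ω) i j).symm
    rw [this]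
    exact continuous_star.measurable.comp
      (measurable_entry_of_lt hij (h _ Sym2.eq_swap) (h _ Sym2.eq_swap))

end Coordinates

theorem measurable_realCoordinate {Ω : Type*} [MeasurableSpace Ω] {N : ℕ}
    {M : Ω → HermitianMatrix N} (hM : ∀ i j, Measurable fun ω => entry (M ω) i j)
    (c : Fin N ⊕ (UpperIndex N ⊕ UpperIndex N)) : Measurable fun ω => realCoordinate (M ω) c := by
  rcases c with i | p | p
  · exact Complex.measurable_re.comp (hM i i)
  · exact Complex.measurable_re.comp (hM p.1.1 p.1.2)
  · exact Complex.measurable_im.comp (hM p.1.1 p.1.2)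

/-- Entries at a pair are functions of the coordinates lying over it, and disjoint sets of pairs
have disjoint sets of coordinates over them. -/
theorem IsWignerMatrix.hasIndependentPairs {Ω : Type*} [MeasurableSpace Ω] {P : Measure Ω} {N : ℕ}
    {M : Ω → HermitianMatrix N} (hM : IsWignerMatrix P M) :
    HasIndependentPairs P fun ω => (M ω : Matrix (Fin N) (Fin N) ℂ) where
  isHermitian ω := Matrix.isHermitian_iff_isSelfAdjoint.mpr (M ω).2
  measurable_entry := hM.measurable_entry
  mean := hM.mean_offDiagonal
  indep E F hEF := by
    have hle : ∀ E : Set (Sym2 (Fin N)), pairSigma (fun ω => (M ω : Matrix (Fin N) (Fin N) ℂ)) E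
        ≤ ⨆ c ∈ coordinatePair ⁻¹' E,
          MeasurableSpace.comap (fun ω => realCoordinate (M ω) c) inferInstance := fun E => by
      refine iSup_le fun i => iSup_le fun j => iSup_le fun hij => Measurable.comap_le ?_
      refine measurable_entry_of_coordinates (M := M) fun c hc => ?_
      refine Measurable.mono (comap_measurable _) ?_ le_rfl
      exact le_iSup₂_of_le c (by simpa [hc] using hij) le_rfl
    exact indep_of_indep_of_le_left (indep_of_indep_of_le_right (indep_iSup_of_disjoint
      (fun c => (measurable_realCoordinate hM.measurable_entry c).comap_le) hM.indep
      (hEF.preimage coordinatePair)) (hle F)) (hle E)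

end WignerLaw

/-! ### The semicircle law. -/

theorem mainTheorem2 {Ω : ℕ → Type*} [∀ N, MeasurableSpace (Ω N)]
    (P : ∀ N, Measure (Ω N)) [∀ N, IsProbabilityMeasure (P N)]
    (M : ∀ N, Ω N → WignerLaw.HermitianMatrix N)
    (hWigner : ∀ N, WignerLaw.IsWignerMatrix (P N) (M N))
    (hMoments : ∀ k : ℕ, ∃ C : ℝ, ∀ (N : ℕ) (i j : Fin N),
      Integrable (fun ω => ‖WignerLaw.entry (M N ω) i j‖ ^ k) (P N) ∧
        ∫ ω, ‖WignerLaw.entry (M N ω) i j‖ ^ k ∂(P N) ≤ C)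
    (αN : ℕ → ℝ)
    (hαN : ∀ (N : ℕ) (i j : Fin N), i ≠ j →
      WignerLaw.secondCumulant (P N) (fun ω => WignerLaw.entry (M N ω) i j)
        (fun ω => WignerLaw.entry (M N ω) j i) = ((αN N ^ 2 : ℝ) : ℂ))
    (α : ℝ) (hα : 0 < α) (hlim : Tendsto αN atTop (𝓝 α)) (k : ℕ) :
    (∀ N, Integrable (fun x : ℝ => x ^ k) (WignerLaw.eigenvalueDensity (P N) (M N))) ∧
      Tendsto (fun N => ∫ x, x ^ k ∂(WignerLaw.eigenvalueDensity (P N) (M N))) atTop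
        (𝓝 (WignerLaw.semicircleMoment α k)) := by
  have hW : WignerLaw.IsWignerSequence P
      (fun N ω => (M N ω : Matrix (Fin N) (Fin N) ℂ)) αN := by
    refine ⟨fun N => (hWigner N).hasIndependentPairs, fun p => ?_, fun N i j hij => ?_⟩
    · obtain ⟨C, hC⟩ := hMoments p
      refine ⟨C.toNNReal, fun N i j => ?_⟩
      have h := ofReal_integral_norm_eq_lintegral_enorm (hC N i j).1
      simp only [norm_pow, norm_norm, enorm_pow, enorm_norm] at h
      refine (h.symm.trans_le ?_)
      exact ENNReal.ofReal_le_ofReal (hC N i j).2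
    · have h := hαN N i j hij
      rw [WignerLaw.secondCumulant, (hWigner N).mean_offDiagonal i j hij, zero_mul, sub_zero] at h
      exact h
  have hkey : ∀ N : ℕ, N ≠ 0 →
      Integrable (fun x : ℝ => x ^ k) (WignerLaw.eigenvalueDensity (P N) (M N)) ∧
      ((∫ x, x ^ k ∂(WignerLaw.eigenvalueDensity (P N) (M N)) : ℝ) : ℂ)
        = ∫ ω, (N : ℂ)⁻¹ * (WignerLaw.scaled
          (fun N ω => (M N ω : Matrix (Fin N) (Fin N) ℂ)) N ω ^ k).trace ∂P N := by
    intro N hN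
    have : NeZero N := ⟨hN⟩
    exact WignerLaw.integrable_and_integral_bind_empiricalSpectralMeasure
      (A := fun ω => (√(N : ℝ))⁻¹ • M N ω) (hW.scaled_pairs N).measurable_entry
      (fun k => integrable_finsetSum _ fun i _ => hW.integrable_scaled_pow_apply N k i i) k
  refine ⟨fun N => ?_, ?_⟩
  · rcases Nat.eq_zero_or_pos N with rfl | hN
    -- For `N = 0` the sum of Dirac masses is empty, so the density is zero although its prefactor
    -- is `0⁻¹ = ⊤`.
    · have : WignerLaw.eigenvalueDensity (P 0) (M 0) = 0 := by
        simp [WignerLaw.eigenvalueDensity, WignerLaw.empiricalSpectralMeasure]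
      rw [this]
      exact integrable_zero_measure
    · exact (hkey N hN.ne').1
  · have h := (Complex.continuous_re.tendsto _).comp (hW.tendsto_integral_trace hlim
      (WignerLaw.semicircleMoment_zero hα) (WignerLaw.semicircleMoment_odd α odd_one)
      (WignerLaw.semicircleMoment_add_two hα) k)
    rw [Complex.ofReal_re] at h
    refine h.congr' ?_
    filter_upwards [eventually_ne_atTop 0] with N hN
    simp only [Function.comp_apply]
    rw [← (hkey N hN).2, Complex.ofReal_re]
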